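/- Let $A$ be a $\mathbb Q$-vector space (of any dimension). A \emph{$\mathbb Q$-brace} on $A$ is an operation $\circ$ on $A$ such that $(A,\circ)$ is a group and, writing $a*b=a\circ b-a-b$, one has $a\circ(b+c)+a=a\circ b+a\circ c$ and $a*(eb)=e(a*b)$ for all $a,b,c\in A$, $e\in\mathbb Q$. Put $A^{[1]}=A$ and, for $i\ge 2$, let $A^{[i]}$ be the additive subgroup generated by all $a*b$ with $a\in A^{[j]}$, $b\in A^{[i-j]}$, $0<j<i$. The brace is \emph{strongly nilpotent} if $A^{[n]}=0$ for some $n\geq 1$. A \emph{pre-Lie algebra structure} on $A$ is a $\mathbb Q$-bilinear product $\cdot$ with $(x\cdot y)\cdot z-x\cdot(y\cdot z)=(y\cdot x)\cdot z-y\cdot(x\cdot z)$ for all $x,y,z \in A$. It is \emph{nilpotent} if for some $n\ge 1$ all products of $n$ elements, with any distribution of brackets, are zero. For such a product write $L_a(b)=a\cdot b$, $e^{L_a}(b)=\sum_{k\ge 0}\frac1{k!}L_a^k(b)$ and $W(a)=\sum_{k\ge 0}\frac1{(k+1)!}L_a^k(a)=a+\frac1{2!}a\cdot a+\frac1{3!}a\cdot(a\cdot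 a)+\cdots$; these are finite sums. Then there is a bijection between the set of strongly nilpotent $\mathbb Q$-braces on $A$ and the set of nilpotent pre-Lie algebra structures on $A$ such that: (1) the pre-Lie product corresponding to a strongly nilpotent $\mathbb Q$-brace $(A,+,\circ)$ is the limit product $$a\cdot b=\lim_{n\to\infty}2^n\Bigl(\bigl(\tfrac1{2^n}a\bigr)*b\Bigr)\qquad(a,b\in A),$$ where the limit exists for all $a,b$, in the sense that the sequence and its limit lie in a finite-dimensional subspace of $A$ and the coordinates converge in $\mathbb Q$; (2) the brace corresponding to a nilpotent pre-Lie algebra $(A,+,\cdot)$ is its group of flows: $W:A\to A$ is a bijection and, with $\Omega=W^{-1}$, $$a\circ b=a+e^{L_{\Omega(a)}}(b)\qquad(a,b\in A).$$ -/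

import Mathlib

open Filter Topology

/-- A pre-Lie algebra over `ℚ` with underlying vector space `A`: a bilinear product on `A` with
`(xy)z - x(yz) = (yx)z - y(xz)`. -/
@[ext]
structure PreLieStructure (A : Type*) [AddCommGroup A] [Module ℚ A] where
  mul : A →ₗ[ℚ] A →ₗ[ℚ] A
  preLie : ∀ x y z : A,
    mul (mul x y) z - mul x (mul y z) = mul (mul y x) z - mul y (mul x z)

/-- A `ℚ`-brace with underlying `ℚ`-vector space `A`: an operation `∘` making `A` a group such that
`a ∘ (b + c) + a = a ∘ b + a ∘ c`, and such that `a * (e b) = e (a * b)` for `e ∈ ℚ`, where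
`a * b = a ∘ b - a - b`. -/
@[ext]
structure QBraceStructure (A : Type*) [AddCommGroup A] [Module ℚ A] where
  circ : A → A → A
  isGroup : ∃ _ : Group A, ∀ a b : A, circ a b = a * b
  circ_add : ∀ a b c : A, circ a (b + c) + a = circ a b + circ a c
  star_smul : ∀ (a b : A) (e : ℚ), circ a (e • b) - a - e • b = e • (circ a b - a - b)

namespace PreLieStructure

variable {A : Type*} [AddCommGroup A] [Module ℚ A]

/-- The same object as a Mathlib left pre-Lie ring. -/
@[reducible]
def toLeftPreLieRing (P : PreLieStructure A) : LeftPreLieRing A where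
  mul x y := P.mul x y
  left_distrib x y z := (P.mul x).map_add y z
  right_distrib x y z := P.mul.map_add₂ x y z
  zero_mul x := P.mul.map_zero₂ x
  mul_zero x := (P.mul x).map_zero
  assoc_symm' x y z := P.preLie x y z

/-- The same object as a Mathlib left pre-Lie algebra. -/
@[reducible]
def toLeftPreLieAlgebra (P : PreLieStructure A) :
    @LeftPreLieAlgebra ℚ _ A P.toLeftPreLieRing :=
  letI := P.toLeftPreLieRing
  { (inferInstance : Module ℚ A) with
    smul_assoc := fun r x y => P.mul.map_smul₂ r x y
    smul_comm := fun r x y => ((P.mul x).map_smul r y).symm }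

/-- `P.IsProduct n x`: the element `x` is a product of `n` elements of the algebra, with some
distribution of brackets. -/
inductive IsProduct (P : PreLieStructure A) : ℕ → A → Prop
  | single (a : A) : IsProduct P 1 a
  | mul {m n : ℕ} {a b : A} (ha : IsProduct P m a) (hb : IsProduct P n b) :
      IsProduct P (m + n) (P.mul a b)

/-- For some `n ≥ 1`, all products of `n` elements are zero. -/
def IsNilpotent (P : PreLieStructure A) : Prop :=
  ∃ n : ℕ, 1 ≤ n ∧ ∀ x : A, P.IsProduct n x → x = 0

/-- The exponential `e^{L_a}` of the left multiplication `L_a = P.mul a`, for `L_a` nilpotent. -/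
noncomputable def expL (P : PreLieStructure A) (a : A) : Module.End ℚ A :=
  _root_.IsNilpotent.exp (P.mul a : Module.End ℚ A)

/-- `W(a) = e^{L_a}(1) - 1 = a + (1/2!) a·a + (1/3!) a·(a·a) + ⋯`, for `L_a` nilpotent (the omitted
terms contain a zero power of `L_a`). -/
noncomputable def W (P : PreLieStructure A) (a : A) : A :=
  ∑ k ∈ Finset.range (nilpotencyClass (P.mul a : Module.End ℚ A)),
    ((Nat.factorial (k + 1) : ℚ)⁻¹) • ((P.mul a : Module.End ℚ A) ^ k) a

end PreLieStructure

namespace QBraceStructure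

variable {A : Type*} [AddCommGroup A] [Module ℚ A]

/-- `a * b = a ∘ b - a - b`. -/
def star (B : QBraceStructure A) (a b : A) : A := B.circ a b - a - b

/-- The chain `A^{[1]} = A`, and, for `i ≥ 2`, `A^{[i]}` is the additive subgroup generated by the
elements `a * b` with `a ∈ A^{[j]}`, `b ∈ A^{[i-j]}`, `0 < j < i`. The unused index `0` carries
`A`. -/
def strongChain (B : QBraceStructure A) : ℕ → AddSubgroup A
  | 0 => ⊤
  | 1 => ⊤
  | i + 2 => AddSubgroup.closure
      {x : A | ∃ (j : ℕ) (_ : 0 < j) (_ : j < i + 2),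
        ∃ a ∈ strongChain B j, ∃ b ∈ strongChain B (i + 2 - j), x = B.star a b}
termination_by i => i
decreasing_by all_goals omega

/-- `A^{[n]} = 0` for some `n`. -/
def IsStronglyNilpotent (B : QBraceStructure A) : Prop :=
  ∃ n : ℕ, B.strongChain n = ⊥

end QBraceStructure

/-- The sequence `u` converges to `l` inside some finite-dimensional subspace `V` of the rational
vector space `A`, with respect to the coordinates of `V` (equivalently, after applying any linear
functional) and the usual topology of `ℚ`. -/
def ConvergesTo {A : Type*} [AddCommGroup A] [Module ℚ A] (u : ℕ → A) (l : A) : Prop :=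
  ∃ V : Submodule ℚ A, FiniteDimensional ℚ V ∧ (∀ n, u n ∈ V) ∧ l ∈ V ∧
    ∀ φ : Module.Dual ℚ A, Tendsto (fun n => φ (u n)) atTop (𝓝 (φ l))

/-- `a · b = lim_{n → ∞} 2^n ((1/2^n) a) * b` for all `a`, `b`; the limits exist. -/
def IsLimitProduct {A : Type*} [AddCommGroup A] [Module ℚ A]
    (B : QBraceStructure A) (P : PreLieStructure A) : Prop :=
  ∀ a b : A,
    ConvergesTo (fun n : ℕ => (2 ^ n : ℚ) • B.star ((1 / 2 ^ n : ℚ) • a) b) (P.mul a b)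

/-- The brace `B` is the group of flows of `P`: the map `W` is a bijection, with inverse `Ω`, and
`a ∘ b = a + e^{L_{Ω(a)}}(b)`. -/
def IsGroupOfFlows {A : Type*} [AddCommGroup A] [Module ℚ A]
    (P : PreLieStructure A) (B : QBraceStructure A) : Prop :=
  ∃ Ω : A → A, Function.LeftInverse Ω P.W ∧ Function.RightInverse Ω P.W ∧
    ∀ a b : A, B.circ a b = a + P.expL (Ω a) b

/-! Both structures encode a simply transitive unipotent affine action on `A`, seen globally for the
brace and infinitesimally for the pre-Lie algebra.

From pre-Lie to brace: send `a` to the affine vector field `X_a : b ↦ a·b + a`, realised as a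
nilpotent endomorphism of `A × ℚ`. The pre-Lie identity gives `[X_a, X_b] = X_{a·b - b·a}`, so these
fields form a Lie algebra and, by Baker-Campbell-Hausdorff (`exists_exp_mul_exp_eq_exp`), their
exponentials are closed under products. The map `exp X_a` has linear part `e^{L_a}` and translation
part `W(a)`. As `W` is the identity plus a contraction for the lower series, it is bijective;
labelling each exponential by its translation part gives the group of flows.

From brace to pre-Lie: put `λ_a(b) = a ∘ b - a`, a linear map with `λ_{a∘b} = λ_a λ_b`. Strong
nilpotency forces `n ↦ λ_{na}` to be polynomial in `n` (`lam_sub_one_mem_polyCurves`). Its linear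
coefficient is `L_a`. Comparing coefficients in `λ_{na∘nb} = λ_{na} λ_{nb}`, degree one says that
`L` is additive and degree two, antisymmetrised, is the pre-Lie identity. Evaluating the polynomial
at `1/2^m` gives the limit formula.

The two passages are inverse. The powers of `a` in `(A,∘)` are integer points of a one-parameter
group `exp(tX)`; if `v` is its velocity, comparing linear terms gives `X = X_v`, and time one gives
`a = W(v)` and `λ_a = e^{L_v}`. Conversely, the flows determine the fields because `exp` is
injective on nilpotent operators. -/

/-! ### Logarithms of unipotent elements -/

open Finset in
-- A logarithm of `1 + N` by successive correction: `exp(-N)(1 + N) = 1 + N²s`, and `N²s` has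
-- smaller nilpotency order, so its logarithm is known by induction and is added to `N`. The
-- factored form `N * q` keeps the logarithm inside any space stable under right multiplication by
-- `q` that contains `N`.
theorem IsNilpotent.exists_exp_mul_eq_one_add {R : Type*} [Ring R] [Algebra ℚ R] (m : ℕ) (N : R)
    (hN : N ^ (m + 1) = 0) : ∃ q ∈ Algebra.adjoin ℚ {N}, IsNilpotent.exp (N * q) = 1 + N := by
  induction m generalizing N with
  | zero =>
    have h0 : N = 0 := by simpa using hN
    exact ⟨0, zero_mem _, by simp [h0]⟩
  | succ m ih =>
    have hNn : IsNilpotent N := ⟨_, hN⟩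
    set S := Algebra.adjoin ℚ {N} with hS
    have hNS : N ∈ S := Algebra.subset_adjoin rfl
    have hcomm : ∀ x ∈ S, Commute N x := fun x hx =>
      Algebra.commute_of_mem_adjoin_self hx
    have key : ∃ r ∈ S, IsNilpotent.exp (-N) = 1 - N + N ^ 2 * r := by
      refine ⟨∑ i ∈ range m, ((i + 2).factorial : ℚ)⁻¹ • ((-1) ^ i * N ^ i), ?_, ?_⟩
      · refine S.sum_mem fun i _ => S.smul_mem (S.mul_mem ?_ (S.pow_mem hNS _)) _
        exact S.pow_mem (S.neg_mem S.one_mem) _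
      · have : (-N) ^ (m + 2) = 0 := by rw [neg_pow, hN, mul_zero]
        rw [IsNilpotent.exp_eq_sum this, sum_range_succ', sum_range_succ', mul_sum]
        have : ∀ i ∈ range m, ((i + 1 + 1).factorial : ℚ)⁻¹ • (-N) ^ (i + 1 + 1) =
            N ^ 2 * ((i + 2).factorial : ℚ)⁻¹ • ((-1) ^ i * N ^ i) := by
          intro i _
          rw [mul_smul_comm]
          congr 1
          have h1 : Commute (N ^ 2) ((-1) ^ i) :=
            (((Commute.one_right (N ^ 2)).neg_right).pow_right i)
          rw [neg_pow, ← mul_assoc, h1.eq, mul_assoc, ← pow_add, add_comm 2 i,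
            show (-1 : R) ^ (i + 1 + 1) = (-1) ^ i by simp [_root_.pow_succ]]
        rw [sum_congr rfl this]
        simp
        abel
    obtain ⟨r, hr, hrexp⟩ := key
    have hrN := hcomm r hr
    obtain ⟨s, hs, hsN⟩ : ∃ s ∈ S, IsNilpotent.exp (-N) * (1 + N) - 1 = N ^ 2 * s := by
      refine ⟨-1 + r + r * N, ?_, ?_⟩
      · exact S.add_mem (S.add_mem (S.neg_mem S.one_mem) hr) (S.mul_mem hr hNS)
      · rw [hrexp]; noncomm_ring
    have hNs := hcomm s hs
    set N' := N ^ 2 * s with hN'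
    have hN'S : N' ∈ S := S.mul_mem (S.pow_mem hNS _) hs
    -- The induction descends because `2(m + 1) ≥ m + 2`.
    have hN'0 : N' ^ (m + 1) = 0 := by
      rw [hN', (hNs.pow_left 2).mul_pow, ← pow_mul,
        pow_eq_zero_of_le (by omega : m + 1 + 1 ≤ 2 * (m + 1)) hN, zero_mul]
    obtain ⟨q, hq, hexp⟩ := ih N' hN'0
    have hqS : q ∈ S := (Algebra.adjoin_le (by simpa using hN'S) : _ ≤ S) hq
    have hq' : Commute N' q := Algebra.commute_of_mem_adjoin_self hq
    refine ⟨1 + N * s * q, S.add_mem S.one_mem (S.mul_mem (S.mul_mem hNS hs) hqS), ?_⟩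
    have e1 : N * (1 + N * s * q) = N + N' * q := by
      rw [hN']; noncomm_ring
    have hnil : IsNilpotent (N' * q) := hq'.isNilpotent_mul_right ⟨_, hN'0⟩
    rw [e1, IsNilpotent.exp_add_of_commute (hcomm _ (S.mul_mem hN'S hqS)) hNn hnil, hexp, ← hsN,
      add_sub_cancel, ← mul_assoc, IsNilpotent.exp_mul_exp_neg_self hNn, one_mul]

theorem IsNilpotent.exp_natCast_smul {R : Type*} [Ring R] [Algebra ℚ R] {a : R}
    (ha : IsNilpotent a) (n : ℕ) :
    IsNilpotent.exp ((n : ℚ) • a) = IsNilpotent.exp a ^ n := by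
  induction n with
  | zero => simp
  | succ n ih =>
    rw [Nat.cast_succ, add_smul, one_smul, IsNilpotent.exp_add_of_commute
      ((Commute.refl _).smul_left _) (ha.smul _) ha, ih, _root_.pow_succ]

/-! ### Conjugation by exponentials and the logarithmic derivative -/

section Conjugation

variable {R : Type*} [Ring R] [Algebra ℚ R]

/-- The commutator `x ↦ a x - x a` as a linear map. -/
noncomputable def commutatorMap (a : R) : Module.End ℚ R :=
  LinearMap.mulLeft ℚ a - LinearMap.mulRight ℚ a

theorem commutatorMap_apply (a x : R) : commutatorMap a x = a * x - x * a := rfl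

theorem commute_mulLeft_mulRight' (a b : R) :
    Commute (LinearMap.mulLeft ℚ a : Module.End ℚ R) (LinearMap.mulRight ℚ b) := by
  ext x; simp [mul_assoc]

theorem isNilpotent_mulLeft {a : R} (ha : IsNilpotent a) :
    IsNilpotent (LinearMap.mulLeft ℚ a : Module.End ℚ R) := by
  obtain ⟨k, hk⟩ := ha
  exact ⟨k, by rw [LinearMap.pow_mulLeft, hk, LinearMap.mulLeft_zero_eq_zero]⟩

theorem isNilpotent_mulRight {a : R} (ha : IsNilpotent a) :
    IsNilpotent (LinearMap.mulRight ℚ a : Module.End ℚ R) := by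
  obtain ⟨k, hk⟩ := ha
  exact ⟨k, by rw [LinearMap.pow_mulRight, hk, LinearMap.mulRight_zero_eq_zero]⟩

theorem isNilpotent_commutatorMap {a : R} (ha : IsNilpotent a) :
    IsNilpotent (commutatorMap a) :=
  (commute_mulLeft_mulRight' a a).isNilpotent_sub (isNilpotent_mulLeft ha)
    (isNilpotent_mulRight ha)

theorem exp_mulLeft_apply {a : R} (ha : IsNilpotent a) (x : R) :
    IsNilpotent.exp (LinearMap.mulLeft ℚ a : Module.End ℚ R) x = IsNilpotent.exp a * x := by
  obtain ⟨k, hk⟩ := ha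
  have h : (LinearMap.mulLeft ℚ a : Module.End ℚ R) ^ k = 0 := by
    rw [LinearMap.pow_mulLeft, hk, LinearMap.mulLeft_zero_eq_zero]
  simp [IsNilpotent.exp_eq_sum hk, IsNilpotent.exp_eq_sum h, Finset.sum_mul,
    LinearMap.pow_mulLeft]

theorem exp_mulRight_apply {a : R} (ha : IsNilpotent a) (x : R) :
    IsNilpotent.exp (LinearMap.mulRight ℚ a : Module.End ℚ R) x = x * IsNilpotent.exp a := by
  obtain ⟨k, hk⟩ := ha
  have h : (LinearMap.mulRight ℚ a : Module.End ℚ R) ^ k = 0 := by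
    rw [LinearMap.pow_mulRight, hk, LinearMap.mulRight_zero_eq_zero]
  simp [IsNilpotent.exp_eq_sum hk, IsNilpotent.exp_eq_sum h, Finset.mul_sum,
    LinearMap.pow_mulRight]

/-- The commutator with `a` is the sum of two commuting nilpotent operators, left multiplication by
`a` and right multiplication by `-a`, so its exponential factors. -/
theorem exp_commutatorMap_apply {a : R} (ha : IsNilpotent a) (x : R) :
    IsNilpotent.exp (commutatorMap a) x = IsNilpotent.exp a * x * IsNilpotent.exp (-a) := by
  have h : commutatorMap a = LinearMap.mulLeft ℚ a + LinearMap.mulRight ℚ (-a) := by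
    ext y; simp [commutatorMap_apply, sub_eq_add_neg]
  rw [h, IsNilpotent.exp_add_of_commute (commute_mulLeft_mulRight' a (-a)) (isNilpotent_mulLeft ha)
    (isNilpotent_mulRight ha.neg), Module.End.mul_apply, exp_mulRight_apply ha.neg,
    exp_mulLeft_apply ha, mul_assoc]

/-- The logarithmic derivative of an exponential. -/
theorem exp_neg_mul_derivation_exp (δ : R →ₗ[ℚ] R)
    (hδ : ∀ x y, δ (x * y) = δ x * y + x * δ y) {Z : R} (hZ : IsNilpotent Z) :
    ∃ m : ℕ, IsNilpotent.exp (-Z) * δ (IsNilpotent.exp Z) =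
      ∑ k ∈ Finset.range m, ((k + 2).factorial : ℚ)⁻¹ • ((commutatorMap (-Z)) ^ (k + 1)) (δ Z) +
        δ Z := by
  have hδ1 : δ 1 = 0 := by simpa using hδ 1 1
  set a : Module.End ℚ R := LinearMap.mulLeft ℚ (-Z) with ha
  have hna : -a = LinearMap.mulLeft ℚ Z := by ext y; simp [ha]
  have han : IsNilpotent a := isNilpotent_mulLeft hZ.neg
  obtain ⟨m, hm⟩ := isNilpotent_commutatorMap han
  refine ⟨m, ?_⟩
  -- The conjugation formula is used in the ring of endomorphisms of `R`, on the element `δ` itself;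
  -- evaluating at `1` yields the logarithmic derivative.
  have h := congrArg (fun f : Module.End ℚ R => f 1)
    (exp_commutatorMap_apply han (δ : Module.End ℚ R))
  simp only [Module.End.mul_apply] at h
  rw [hna, exp_mulLeft_apply hZ, exp_mulLeft_apply hZ.neg, mul_one] at h
  rw [← h]
  -- By the Leibniz rule, `[-Z, δ]` is left multiplication by `δ Z`; later commutators stay among
  -- left multiplications.
  have hk : ∀ k, ((commutatorMap a) ^ (k + 1)) (δ : Module.End ℚ R) =
      LinearMap.mulLeft ℚ (((commutatorMap (-Z)) ^ k) (δ Z)) := by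
    intro k
    induction k with
    | zero =>
      ext y
      simp [commutatorMap_apply, ha, hδ]
    | succ k ih =>
      rw [pow_succ', Module.End.mul_apply, ih, pow_succ' (commutatorMap (-Z)), Module.End.mul_apply]
      ext y
      simp [commutatorMap_apply, ha, add_mul, mul_assoc]
  have hm2 : (commutatorMap a) ^ (m + 2) = 0 := by rw [pow_add, hm, zero_mul]
  rw [IsNilpotent.exp_eq_sum hm2, Finset.sum_range_succ', Finset.sum_range_succ']
  have hk0 : commutatorMap a (δ : Module.End ℚ R) = LinearMap.mulLeft ℚ (δ Z) := by
    simpa using hk 0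
  simp [hk, hk0, hδ1, LinearMap.sum_apply]

end Conjugation

/-! ### A qualitative Baker-Campbell-Hausdorff theorem -/

section BakerCampbellHausdorff

open Polynomial

variable {R : Type*} [Ring R] [Algebra ℚ R]

theorem Polynomial.pow_coeff_mem (K : Submodule ℚ R) {f : R[X]} (hf : ∀ n, f.coeff n ∈ K) (m : ℕ) :
    ∀ n, (f ^ m).coeff n ∈ K ^ m := by
  induction m with
  | zero =>
    intro n
    rw [pow_zero f, coeff_one, pow_zero]
    split_ifs
    · exact Submodule.one_le.mp le_rfl
    · exact zero_mem _
  | succ m ih =>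
    intro n
    rw [pow_succ f, coeff_mul, pow_succ]
    exact Submodule.sum_mem _ fun p _ => Submodule.mul_mem_mul (ih _) (hf _)

theorem Polynomial.mul_coeff_mem {K : Submodule ℚ R} (hK : ∀ a ∈ K, ∀ b ∈ K, a * b ∈ K)
    {f g : R[X]} (hf : ∀ n, f.coeff n ∈ K) (hg : ∀ n, g.coeff n ∈ K) :
    ∀ n, (f * g).coeff n ∈ K := by
  intro n
  rw [coeff_mul]
  exact Submodule.sum_mem _ fun p _ => hK _ (hf _) _ (hg _)

theorem Polynomial.isNilpotent_of_coeff_mem {K : Submodule ℚ R} {m : ℕ} (hm : K ^ m = ⊥)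
    {f : R[X]} (hf : ∀ n, f.coeff n ∈ K) : IsNilpotent f := by
  refine ⟨m, Polynomial.ext fun n => ?_⟩
  have := pow_coeff_mem K hf m n
  rw [hm] at this
  simpa using this

theorem Polynomial.exp_sub_one_coeff_mem {K : Submodule ℚ R}
    (hK : ∀ a ∈ K, ∀ b ∈ K, a * b ∈ K) {f : R[X]} (hfn : IsNilpotent f)
    (hf : ∀ n, f.coeff n ∈ K) : ∀ n, (IsNilpotent.exp f - 1).coeff n ∈ K := by
  obtain ⟨m, hm⟩ := hfn
  have hm1 : f ^ (m + 1) = 0 := by rw [pow_succ, hm, zero_mul]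
  have hp : ∀ i n, (f ^ (i + 1)).coeff n ∈ K := by
    intro i
    induction i with
    | zero => simpa using hf
    | succ i ih => rw [pow_succ]; exact mul_coeff_mem hK ih hf
  intro n
  rw [IsNilpotent.exp_eq_sum hm1, Finset.sum_range_succ']
  simp only [Nat.factorial_zero, Nat.cast_one, inv_one, pow_zero, one_smul, add_sub_cancel_right,
    finsetSum_coeff, coeff_smul]
  exact Submodule.sum_mem _ fun i _ => K.smul_mem _ (hp _ _)

/-- Evaluation at `1` for polynomials over a possibly noncommutative ring. -/
noncomputable def Polynomial.evalOneHom (R : Type*) [Ring R] : R[X] →+* R :=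
  eval₂RingHom' (RingHom.id R) 1 fun a => Commute.one_right a

omit [Algebra ℚ R] in
theorem Polynomial.evalOneHom_C_mul_X (x : R) : evalOneHom R (C x * X) = x := by
  simp [evalOneHom]

theorem Polynomial.evalOneHom_mem {K : Submodule ℚ R} {f : R[X]} (hf : ∀ n, f.coeff n ∈ K) :
    evalOneHom R f ∈ K := by
  have : evalOneHom R f = ∑ n ∈ f.support, f.coeff n := by
    simp [evalOneHom, eval₂_eq_sum, Polynomial.sum]
  rw [this]
  exact Submodule.sum_mem _ fun n _ => hf n

/-- Since `f` has no constant term, the coefficient of degree `j` in `[f, g]` sees only coefficients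
of `g` of degree below `j`. This strictness drives the induction on coefficients of the logarithm.
-/
theorem Polynomial.commutatorMap_coeff_mem {L : Submodule ℚ R}
    (hL : ∀ a ∈ L, ∀ b ∈ L, a * b - b * a ∈ L) {f g : R[X]} {m : ℕ} (hf0 : f.coeff 0 = 0)
    (hf : ∀ j ≤ m, f.coeff j ∈ L) (hg : ∀ j < m, g.coeff j ∈ L) :
    ∀ j ≤ m, (commutatorMap f g).coeff j ∈ L := by
  intro j hj
  rw [commutatorMap_apply, coeff_sub, coeff_mul, coeff_mul,
    ← Finset.Nat.sum_antidiagonal_swap (f := fun p => g.coeff p.1 * f.coeff p.2),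
    ← Finset.sum_sub_distrib]
  refine Submodule.sum_mem _ fun p hp => ?_
  rw [Finset.HasAntidiagonal.mem_antidiagonal] at hp
  rcases Nat.eq_zero_or_pos p.1 with h | h
  · simp [h, hf0]
  · exact hL _ (hf _ (by omega)) _ (hg _ (by omega))

theorem Polynomial.commutatorMap_coeff_mem_of_forall {L : Submodule ℚ R}
    (hL : ∀ a ∈ L, ∀ b ∈ L, a * b - b * a ∈ L) {f g : R[X]}
    (hf : ∀ j, f.coeff j ∈ L) (hg : ∀ j, g.coeff j ∈ L) :
    ∀ j, (commutatorMap f g).coeff j ∈ L := by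
  intro j
  rw [commutatorMap_apply, coeff_sub, coeff_mul, coeff_mul,
    ← Finset.Nat.sum_antidiagonal_swap (f := fun p => g.coeff p.1 * f.coeff p.2),
    ← Finset.sum_sub_distrib]
  exact Submodule.sum_mem _ fun p _ => hL _ (hf _) _ (hg _)

/-- If `Z(0) = 0` and the logarithmic derivative of `exp Z` has coefficients in a Lie subalgebra,
then so does `Z`. -/
theorem Polynomial.coeff_mem_of_exp_neg_mul_derivative_exp {L : Submodule ℚ R}
    (hL : ∀ a ∈ L, ∀ b ∈ L, a * b - b * a ∈ L) {Z : R[X]} (hZ : IsNilpotent Z)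
    (hZ0 : Z.coeff 0 = 0)
    (h : ∀ n, (IsNilpotent.exp (-Z) * derivative (IsNilpotent.exp Z)).coeff n ∈ L) :
    ∀ n, Z.coeff n ∈ L := by
  let δ : R[X] →ₗ[ℚ] R[X] := derivative.restrictScalars ℚ
  obtain ⟨m, hm⟩ := exp_neg_mul_derivation_exp δ (fun x y => derivative_mul) hZ
  change IsNilpotent.exp (-Z) * derivative (IsNilpotent.exp Z) = _ at hm
  intro n
  induction n using Nat.strong_induction_on with
  | _ n ih =>
  rcases n with _ | n
  · rw [hZ0]; exact zero_mem _
  have hδ : ∀ j, (δ Z).coeff j = ((j : ℚ) + 1) • Z.coeff (j + 1) := by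
    intro j
    change (derivative Z).coeff j = _
    rw [coeff_derivative, Algebra.smul_def, map_add, map_natCast, map_one]
    exact_mod_cast (Nat.cast_commute (j + 1) (Z.coeff (j + 1))).eq.symm
  have hZL : ∀ j ≤ n, (-Z).coeff j ∈ L := fun j hj => by
    rw [coeff_neg]; exact neg_mem (ih j (by omega))
  have hk : ∀ k, ∀ j ≤ n, (((commutatorMap (-Z)) ^ (k + 1)) (δ Z)).coeff j ∈ L := by
    intro k
    induction k with
    | zero =>
      rw [zero_add, pow_one]
      refine commutatorMap_coeff_mem hL (by simp [hZ0]) hZL fun j hj => ?_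
      rw [hδ]
      exact L.smul_mem _ (ih _ (by omega))
    | succ k ihk =>
      rw [pow_succ', Module.End.mul_apply]
      exact commutatorMap_coeff_mem hL (by simp [hZ0]) hZL fun j hj => ihk j hj.le
  -- The coefficient of degree `n` is `(n + 1) Z_{n+1}` plus commutators in `Z_0, …, Z_n`, which lie
  -- in `L` by induction.
  have hn := h n
  rw [hm, coeff_add, finsetSum_coeff, hδ] at hn
  have h1 : ∑ k ∈ Finset.range m, (((k + 2).factorial : ℚ)⁻¹ •
      ((commutatorMap (-Z)) ^ (k + 1)) (δ Z)).coeff n ∈ L :=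
    Submodule.sum_mem _ fun k _ => by
      rw [coeff_smul]; exact L.smul_mem _ (hk k n le_rfl)
  have h2 := (Submodule.add_mem_iff_right _ h1).mp hn
  rwa [Submodule.smul_mem_iff _ (by positivity)] at h2

/-- The set `exp L` is closed under multiplication, for a Lie algebra `L` of an associative
nilpotent algebra `K`. -/
theorem exists_exp_mul_exp_eq_exp {K L : Submodule ℚ R} (hLK : L ≤ K)
    (hK : ∀ a ∈ K, ∀ b ∈ K, a * b ∈ K) {m : ℕ} (hm : K ^ m = ⊥)
    (hL : ∀ a ∈ L, ∀ b ∈ L, a * b - b * a ∈ L) {x y : R} (hx : x ∈ L) (hy : y ∈ L) :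
    ∃ z ∈ L, IsNilpotent.exp x * IsNilpotent.exp y = IsNilpotent.exp z := by
  have hcoeff : ∀ {V : Submodule ℚ R} {x : R}, x ∈ V → ∀ n, (C x * X : R[X]).coeff n ∈ V := by
    intro V x hx n
    rw [coeff_C_mul_X]
    split_ifs
    · exact hx
    · exact zero_mem _
  -- A formal time `X` is introduced: `exp(xX) exp(yX) = exp Z` is solved over `R[X]`, the
  -- coefficients of `Z` are shown to lie in `L`, and `X = 1` is substituted.
  set P : R[X] := C x * X with hP
  set Q : R[X] := C y * X with hQ
  have hPn : IsNilpotent P := isNilpotent_of_coeff_mem hm (hcoeff (hLK hx))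
  have hQn : IsNilpotent Q := isNilpotent_of_coeff_mem hm (hcoeff (hLK hy))
  have hconst : ∀ f : R[X], IsNilpotent f → f.coeff 0 = 0 →
      (IsNilpotent.exp f).coeff 0 = 1 := by
    intro f hf hf0
    rw [← constantCoeff_apply, IsNilpotent.map_exp hf, constantCoeff_apply, hf0,
      IsNilpotent.exp_zero]
  set u := IsNilpotent.exp P * IsNilpotent.exp Q - 1 with hu
  have huK : ∀ n, u.coeff n ∈ K := by
    have : u = (IsNilpotent.exp P - 1) * (IsNilpotent.exp Q - 1) + (IsNilpotent.exp P - 1) +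
      (IsNilpotent.exp Q - 1) := by rw [hu]; noncomm_ring
    intro n
    have h1 := exp_sub_one_coeff_mem hK hPn (hcoeff (hLK hx))
    have h2 := exp_sub_one_coeff_mem hK hQn (hcoeff (hLK hy))
    rw [this, coeff_add, coeff_add]
    exact add_mem (add_mem (mul_coeff_mem hK h1 h2 n) (h1 n)) (h2 n)
  have hu0 : u.coeff 0 = 0 := by
    rw [hu, coeff_sub, mul_coeff_zero, hconst P hPn (by simp [hP]), hconst Q hQn (by simp [hQ])]
    simp
  obtain ⟨k, hk⟩ := isNilpotent_of_coeff_mem hm huK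
  obtain ⟨q, hq, hexp⟩ := IsNilpotent.exists_exp_mul_eq_one_add k u (by rw [pow_succ, hk, zero_mul])
  set Z := u * q with hZ
  have hZn : IsNilpotent Z :=
    (Algebra.commute_of_mem_adjoin_self hq).isNilpotent_mul_right ⟨k, hk⟩
  have hZ0 : Z.coeff 0 = 0 := by rw [hZ, mul_coeff_zero, hu0, zero_mul]
  have hexpZ : IsNilpotent.exp Z = IsNilpotent.exp P * IsNilpotent.exp Q := by
    rw [hexp, hu]; abel
  have hder : ∀ x : R, IsNilpotent (C x * X : R[X]) →
      derivative (IsNilpotent.exp (C x * X)) = IsNilpotent.exp (C x * X) * C x := by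
    intro x hx
    let δ : R[X] →ₗ[ℚ] R[X] := derivative.restrictScalars ℚ
    obtain ⟨m, hm⟩ := exp_neg_mul_derivation_exp δ (fun x y => derivative_mul) hx
    have hδ : δ (C x * X) = C x := derivative_C_mul_X x
    have h0 : commutatorMap (-(C x * X)) (C x : R[X]) = 0 := by
      rw [commutatorMap_apply, neg_mul, mul_neg, mul_assoc, X_mul_C]; abel
    rw [hδ, Finset.sum_eq_zero (fun k _ => by
      rw [pow_succ, Module.End.mul_apply, h0, map_zero, smul_zero]), zero_add] at hm
    have h1 := congrArg (IsNilpotent.exp (C x * X : R[X]) * ·) hm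
    simp only [← mul_assoc, IsNilpotent.exp_mul_exp_neg_self hx, one_mul] at h1
    exact h1
  have hexpnZ : IsNilpotent.exp (-Z) = IsNilpotent.exp (-Q) * IsNilpotent.exp (-P) := by
    have h1 : IsNilpotent.exp Z * (IsNilpotent.exp (-Q) * IsNilpotent.exp (-P)) = 1 := by
      rw [hexpZ, mul_assoc, ← mul_assoc (IsNilpotent.exp Q),
        IsNilpotent.exp_mul_exp_neg_self hQn, one_mul, IsNilpotent.exp_mul_exp_neg_self hPn]
    exact left_inv_eq_right_inv (IsNilpotent.exp_neg_mul_exp_self hZn) h1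
  have hZL : ∀ n, Z.coeff n ∈ L := by
    refine coeff_mem_of_exp_neg_mul_derivative_exp hL hZn hZ0 ?_
    -- The logarithmic derivative is `exp(-yX) x exp(yX) + y`, a sum of iterated commutators of `x`
    -- and `y`.
    have : IsNilpotent.exp (-Z) * derivative (IsNilpotent.exp Z) =
        IsNilpotent.exp (commutatorMap (-Q)) (C x) + C y := by
      rw [exp_commutatorMap_apply hQn.neg, neg_neg, hexpZ, derivative_mul, hder x hPn, hder y hQn,
        hexpnZ]
      have h1 := IsNilpotent.exp_neg_mul_exp_self hPn
      have h2 := IsNilpotent.exp_neg_mul_exp_self hQn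
      rw [← hP, ← hQ]
      calc _ = IsNilpotent.exp (-Q) * (IsNilpotent.exp (-P) * IsNilpotent.exp P) * C x *
            IsNilpotent.exp Q + IsNilpotent.exp (-Q) * (IsNilpotent.exp (-P) * IsNilpotent.exp P)
            * IsNilpotent.exp Q * C y := by noncomm_ring
        _ = _ := by rw [h1, mul_one, h2, one_mul]
    intro n
    have hC : ∀ {V : Submodule ℚ R} {x : R}, x ∈ V → ∀ n, (C x : R[X]).coeff n ∈ V := by
      intro V x hx n
      rw [coeff_C]
      split_ifs
      · exact hx
      · exact zero_mem _
    rw [this, coeff_add]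
    refine add_mem ?_ (hC hy n)
    have hk : ∀ k n, (((commutatorMap (-Q)) ^ k) (C x)).coeff n ∈ L := by
      intro k
      induction k with
      | zero => simpa using hC hx
      | succ k ih =>
        rw [pow_succ', Module.End.mul_apply]
        refine commutatorMap_coeff_mem_of_forall hL ?_ ih
        intro j
        rw [coeff_neg]
        exact neg_mem (hcoeff hy j)
    rw [IsNilpotent.exp, LinearMap.sum_apply, finsetSum_coeff]
    refine Submodule.sum_mem _ fun i _ => ?_
    rw [LinearMap.smul_apply, coeff_smul]
    exact L.smul_mem _ (hk _ _)
  refine ⟨evalOneHom R Z, evalOneHom_mem hZL, ?_⟩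
  rw [← IsNilpotent.map_exp hZn, hexpZ, map_mul, IsNilpotent.map_exp hPn, IsNilpotent.map_exp hQn,
    evalOneHom_C_mul_X, evalOneHom_C_mul_X]

end BakerCampbellHausdorff

/-! ### Operators raising a finite flag, and contractions -/

section Flag

variable {M : Type*} [AddCommGroup M] [Module ℚ M]

/-- The endomorphisms that map each step of a flag into the next one. -/
def flagRaising (G : ℕ → Submodule ℚ M) : Submodule ℚ (Module.End ℚ M) where
  carrier := {T | ∀ i, ∀ m ∈ G i, T m ∈ G (i + 1)}
  add_mem' hS hT i m hm := add_mem (hS i m hm) (hT i m hm)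
  zero_mem' _ _ _ := zero_mem _
  smul_mem' c _ hT i m hm := Submodule.smul_mem _ c (hT i m hm)

variable {G : ℕ → Submodule ℚ M}

theorem flagRaising_mul_mem (hG : Antitone G) {S T : Module.End ℚ M} (hS : S ∈ flagRaising G)
    (hT : T ∈ flagRaising G) : S * T ∈ flagRaising G :=
  fun i m hm => hG (Nat.le_succ _) (hS _ _ (hT i m hm))

theorem flagRaising_pow_eq_bot (hG0 : G 0 = ⊤) {n : ℕ} (hn : G n = ⊥) : flagRaising G ^ n = ⊥ := by
  let V : ℕ → Submodule ℚ (Module.End ℚ M) := fun n =>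
    { carrier := {T | ∀ i, ∀ m ∈ G i, T m ∈ G (i + n)}
      add_mem' := fun hS hT i m hm => add_mem (hS i m hm) (hT i m hm)
      zero_mem' := fun _ _ _ => zero_mem _
      smul_mem' := fun c _ hT i m hm => Submodule.smul_mem _ c (hT i m hm) }
  have h : ∀ k, flagRaising G ^ k ≤ V k := by
    intro k
    induction k with
    | zero =>
      refine (pow_zero (flagRaising G)).le.trans ?_
      rw [Submodule.one_le]
      exact fun i m hm => hm
    | succ k ih =>
      refine (pow_succ (flagRaising G) k).le.trans ?_
      rw [Submodule.mul_le]
      intro S hS T hT i m hm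
      have := ih hS _ _ (hT i m hm)
      rwa [add_assoc, add_comm 1 k] at this
  rw [eq_bot_iff]
  intro T hT
  rw [Submodule.mem_bot]
  ext m
  have := h n hT 0 m (hG0 ▸ trivial)
  rwa [zero_add, hn, Submodule.mem_bot] at this

theorem flagRaising_pow_eq_zero (hG0 : G 0 = ⊤) {n : ℕ} (hn : G n = ⊥) {T : Module.End ℚ M}
    (hT : T ∈ flagRaising G) : T ^ n = 0 := by
  have := Submodule.pow_mem_pow _ hT n
  rwa [flagRaising_pow_eq_bot hG0 hn, Submodule.mem_bot] at this

theorem isNilpotent_of_mem_flagRaising (hG0 : G 0 = ⊤) {n : ℕ} (hn : G n = ⊥)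
    {T : Module.End ℚ M} (hT : T ∈ flagRaising G) : IsNilpotent T :=
  ⟨n, flagRaising_pow_eq_zero hG0 hn hT⟩

theorem flagRaising_pow_succ_mem (hG : Antitone G) {T : Module.End ℚ M} (hT : T ∈ flagRaising G)
    (k : ℕ) : T ^ (k + 1) ∈ flagRaising G := by
  induction k with
  | zero => simpa using hT
  | succ k ih => rw [pow_succ]; exact flagRaising_mul_mem hG ih hT

/-- The map `x ↦ x + p x` is bijective if `p` is contracting for a finite flag. -/
theorem bijective_add_of_contracting (hG0 : G 0 = ⊤) {n : ℕ} (hn : G n = ⊥) (p : M → M)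
    (hp : ∀ i x y, x - y ∈ G i → p x - p y ∈ G (i + 1)) :
    Function.Bijective fun x => x + p x := by
  constructor
  · intro x y hxy
    have h : ∀ i, x - y ∈ G i := by
      intro i
      induction i with
      | zero => rw [hG0]; trivial
      | succ i ih =>
        have : x - y = -(p x - p y) := by
          have : x + p x = y + p y := hxy
          rw [eq_neg_iff_add_eq_zero, ← sub_eq_zero.mpr this]; abel
        rw [this]
        exact neg_mem (hp i x y ih)
    have := h n
    rwa [hn, Submodule.mem_bot, sub_eq_zero] at this
  · intro a
    -- Fixed-point iteration for `x = a - p x`: successive differences descend the flag, so it is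
    -- stationary after `n` steps.
    let z : ℕ → M := fun k => (fun x => a - p x)^[k] 0
    have hz : ∀ k, z (k + 1) = a - p (z k) := fun k => Function.iterate_succ_apply' _ _ _
    have h : ∀ k, z k - z (k + 1) ∈ G k := by
      intro k
      induction k with
      | zero => rw [hG0]; trivial
      | succ k ih =>
        rw [hz k, hz (k + 1)]
        have := neg_mem (hp k _ _ ih)
        rwa [neg_sub, ← sub_sub_sub_cancel_left _ _ a] at this
    have := h n
    rw [hn, Submodule.mem_bot, sub_eq_zero, hz] at this
    exact ⟨z n, by simp only; nth_rw 1 [this]; abel⟩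

theorem mem_of_add_mem_of_contracting (hG : Antitone G) (hG0 : G 0 = ⊤) (p : M → M)
    (hp : ∀ i x, x ∈ G i → p x ∈ G (i + 1)) {i : ℕ} {x : M} (hx : x + p x ∈ G i) : x ∈ G i := by
  have h : ∀ j ≤ i, x ∈ G j := by
    intro j
    induction j with
    | zero => intro _; rw [hG0]; trivial
    | succ j ih =>
      intro hj
      have := sub_mem (hG hj hx) (hp j x (ih (by omega)))
      rwa [add_sub_cancel_right] at this
  exact h i le_rfl

end Flag

/-! ### Affine vector fields as endomorphisms of `A × ℚ` -/

section Affine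

variable {A : Type*} [AddCommGroup A] [Module ℚ A]

/-- `∑ D ^ k v / (k + 1)!` for nilpotent `D`: the integral over `[0, 1]` of `exp (t D) v`. -/
noncomputable def expIntegral (D : Module.End ℚ A) (v : A) : A :=
  ∑ k ∈ Finset.range (nilpotencyClass D), ((Nat.factorial (k + 1) : ℚ)⁻¹) • (D ^ k) v

theorem expIntegral_eq_sum {D : Module.End ℚ A} {m : ℕ} (hm : D ^ m = 0) (v : A) :
    expIntegral D v = ∑ k ∈ Finset.range m, ((Nat.factorial (k + 1) : ℚ)⁻¹) • (D ^ k) v := by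
  refine Finset.sum_subset (Finset.range_mono (csInf_le' hm)) fun k _ hk => ?_
  have h : D ^ k = 0 :=
    pow_eq_zero_of_le (by simpa using hk) (pow_nilpotencyClass ⟨m, hm⟩)
  rw [h, LinearMap.zero_apply, smul_zero]

/-- The affine vector field `b ↦ D b + v`, as an endomorphism of `A × ℚ`. -/
noncomputable def affineField (D : Module.End ℚ A) (v : A) : Module.End ℚ (A × ℚ) :=
  (LinearMap.inl ℚ A ℚ).comp (D.coprod (LinearMap.toSpanSingleton ℚ A v))

theorem affineField_apply (D : Module.End ℚ A) (v b : A) (s : ℚ) :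
    affineField D v (b, s) = (D b + s • v, 0) := by
  simp [affineField]

theorem affineField_add (D E : Module.End ℚ A) (v w : A) :
    affineField (D + E) (v + w) = affineField D v + affineField E w := by
  refine LinearMap.ext fun ⟨b, s⟩ => ?_
  simp [affineField_apply, add_add_add_comm]

theorem affineField_smul (c : ℚ) (D : Module.End ℚ A) (v : A) :
    affineField (c • D) (c • v) = c • affineField D v := by
  refine LinearMap.ext fun ⟨b, s⟩ => ?_
  simp [affineField_apply, smul_comm c s]

theorem affineField_mul (D E : Module.End ℚ A) (v w : A) :
    affineField D v * affineField E w = affineField (D * E) (D w) := by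
  refine LinearMap.ext fun ⟨b, s⟩ => ?_
  simp [affineField_apply]

theorem affineField_pow_succ (D : Module.End ℚ A) (v : A) (k : ℕ) :
    affineField D v ^ (k + 1) = affineField (D ^ (k + 1)) ((D ^ k) v) := by
  induction k with
  | zero => simp
  | succ k ih => rw [pow_succ', ih, affineField_mul, ← pow_succ', ← Module.End.mul_apply,
      ← pow_succ']

theorem affineField_injective {D E : Module.End ℚ A} {v w : A}
    (h : affineField D v = affineField E w) : D = E ∧ v = w := by
  constructor
  · ext b
    simpa [affineField_apply] using congrArg (fun f : Module.End ℚ (A × ℚ) => f (b, 0)) h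
  · simpa [affineField_apply] using congrArg (fun f : Module.End ℚ (A × ℚ) => f (0, 1)) h

theorem isNilpotent_affineField {D : Module.End ℚ A} (hD : IsNilpotent D) (v : A) :
    IsNilpotent (affineField D v) := by
  obtain ⟨m, hm⟩ := hD
  refine ⟨m + 2, ?_⟩
  rw [affineField_pow_succ, pow_succ, pow_succ, hm]
  refine LinearMap.ext fun ⟨b, s⟩ => ?_
  simp [affineField_apply]

theorem exp_affineField_apply {D : Module.End ℚ A} (hD : IsNilpotent D) (v b : A) (s : ℚ) :
    IsNilpotent.exp (affineField D v) (b, s) =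
      (IsNilpotent.exp D b + s • expIntegral D v, s) := by
  obtain ⟨m, hm⟩ := hD
  have hm1 : D ^ (m + 1) = 0 := by rw [pow_succ, hm, zero_mul]
  have h : affineField D v ^ (m + 1) = 0 := by
    rw [affineField_pow_succ, hm1, hm]
    refine LinearMap.ext fun ⟨b, s⟩ => ?_
    simp [affineField_apply]
  rw [IsNilpotent.exp_eq_sum h, IsNilpotent.exp_eq_sum hm1, expIntegral_eq_sum hm,
    Finset.sum_range_succ', Finset.sum_range_succ']
  simp only [affineField_pow_succ, LinearMap.add_apply, LinearMap.sum_apply, LinearMap.smul_apply,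
    affineField_apply, Finset.smul_sum]
  refine Prod.ext ?_ ?_
  · simp [Prod.fst_sum, Finset.sum_add_distrib, smul_comm s]
    abel
  · simp [Prod.snd_sum]

/-- The flag on `A × ℚ` induced by a flag on `A`. -/
def affineFlag (F : ℕ → Submodule ℚ A) : ℕ → Submodule ℚ (A × ℚ)
  | 0 => ⊤
  | i + 1 => (F i).prod ⊥

theorem affineFlag_antitone {F : ℕ → Submodule ℚ A} (hF : Antitone F) :
    Antitone (affineFlag F) := by
  refine antitone_nat_of_succ_le fun i => ?_
  cases i with
  | zero => exact le_top
  | succ i => exact Submodule.prod_mono (hF (Nat.le_succ i)) le_rfl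

theorem affineFlag_eq_bot {F : ℕ → Submodule ℚ A} {n : ℕ} (hn : F n = ⊥) :
    affineFlag F (n + 1) = ⊥ := by
  simp [affineFlag, hn]

/-- The extra top step of `affineFlag` absorbs the translation: `v` is only required to lie in `F
0`, which is everything. -/
theorem affineField_mem_flagRaising {F : ℕ → Submodule ℚ A} (hF0 : F 0 = ⊤)
    {D : Module.End ℚ A} (hD : D ∈ flagRaising F) (v : A) :
    affineField D v ∈ flagRaising (affineFlag F) := by
  rintro (_ | i) ⟨b, s⟩ hm
  · rw [affineField_apply]
    exact ⟨by rw [hF0]; trivial, rfl⟩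
  · obtain ⟨hb, hs⟩ := hm
    have hs : s = 0 := hs
    rw [affineField_apply, hs, zero_smul, add_zero]
    exact ⟨hD i b hb, rfl⟩

/-- Raising the flag forces the `ℚ`-component of the image to vanish. This makes the logarithm of a
unipotent affine map an affine field. -/
theorem exists_eq_affineField {F : ℕ → Submodule ℚ A}
    {T : Module.End ℚ (A × ℚ)} (hT : T ∈ flagRaising (affineFlag F)) :
    ∃ D ∈ flagRaising F, ∃ v, T = affineField D v := by
  refine ⟨(LinearMap.fst ℚ A ℚ).comp (T.comp (LinearMap.inl ℚ A ℚ)), ?_, (T (0, 1)).1, ?_⟩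
  · intro i b hb
    exact (hT (i + 1) (b, 0) ⟨hb, rfl⟩).1
  · refine LinearMap.ext fun ⟨b, s⟩ => ?_
    have h : ((b, s) : A × ℚ) = (b, 0) + s • (0, 1) := by simp
    rw [affineField_apply]
    refine Prod.ext ?_ (hT 0 (b, s) trivial).2
    rw [h, map_add, map_smul]
    simp

end Affine

/-! ### From nilpotent pre-Lie algebras to braces -/

namespace PreLieStructure

variable {A : Type*} [AddCommGroup A] [Module ℚ A] (P : PreLieStructure A)

/-- The span of all products of at least `i + 1` elements. -/
def lowerSeries (i : ℕ) : Submodule ℚ A :=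
  Submodule.span ℚ {x | ∃ m, i < m ∧ P.IsProduct m x}

theorem lowerSeries_antitone : Antitone P.lowerSeries := fun _ _ hij =>
  Submodule.span_mono fun _ ⟨m, hm, hx⟩ => ⟨m, hij.trans_lt hm, hx⟩

theorem lowerSeries_zero : P.lowerSeries 0 = ⊤ := by
  rw [eq_top_iff]
  exact fun x _ => Submodule.subset_span ⟨1, one_pos, .single x⟩

variable {P}

theorem IsProduct.pos {n : ℕ} {x : A} (h : P.IsProduct n x) : 0 < n := by
  induction h <;> omega

/-- Reading an innermost product of two elements as a single element shortens a product by one.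
Hence vanishing of the products of exactly `n` elements passes to all longer ones. -/
theorem IsProduct.pred {n : ℕ} {x : A} (h : P.IsProduct n x) :
    1 < n → P.IsProduct (n - 1) x := by
  induction h with
  | single a => intro h; omega
  | @mul m n a b ha hb iha ihb =>
    intro _
    have := ha.pos
    have := hb.pos
    by_cases hm : 1 < m
    · have := IsProduct.mul (iha hm) hb
      rwa [show m - 1 + n = m + n - 1 by omega] at this
    · by_cases hn : 1 < n
      · have := IsProduct.mul ha (ihb hn)
        rwa [show m + (n - 1) = m + n - 1 by omega] at this
      · rw [show m + n - 1 = 1 by omega]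
        exact .single _

theorem IsProduct.of_le {m n : ℕ} {x : A} (h : P.IsProduct m x) (hn : 1 ≤ n) (hnm : n ≤ m) :
    P.IsProduct n x := by
  induction m, hnm using Nat.le_induction with
  | base => exact h
  | succ m hm ih => exact ih (h.pred (by omega))

theorem IsNilpotent.exists_lowerSeries_eq_bot (hP : P.IsNilpotent) : ∃ n, P.lowerSeries n = ⊥ := by
  obtain ⟨n, hn, h⟩ := hP
  refine ⟨n, ?_⟩
  rw [lowerSeries, Submodule.span_eq_bot]
  rintro x ⟨m, hm, hx⟩
  exact h x (hx.of_le hn hm.le)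

theorem mul_mem_lowerSeries {i j : ℕ} {a b : A} (ha : a ∈ P.lowerSeries i)
    (hb : b ∈ P.lowerSeries j) : P.mul a b ∈ P.lowerSeries (i + j + 1) := by
  induction ha, hb using Submodule.span_induction₂ with
  | mem_mem x y hx hy =>
    obtain ⟨m, hm, hx⟩ := hx
    obtain ⟨n, hn, hy⟩ := hy
    exact Submodule.subset_span ⟨m + n, by omega, hx.mul hy⟩
  | zero_left y hy => simp
  | zero_right x hx => simp
  | add_left x y z _ _ _ hx hy => rw [map_add, LinearMap.add_apply]; exact add_mem hx hy
  | add_right x y z _ _ _ hx hy => rw [map_add]; exact add_mem hx hy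
  | smul_left r x y _ _ h => rw [map_smul, LinearMap.smul_apply]; exact Submodule.smul_mem _ _ h
  | smul_right r x y _ _ h => rw [map_smul]; exact Submodule.smul_mem _ _ h

theorem mul_mem_flagRaising (a : A) :
    (P.mul a : Module.End ℚ A) ∈ flagRaising P.lowerSeries := by
  intro i b hb
  have ha : a ∈ P.lowerSeries 0 := by rw [lowerSeries_zero]; trivial
  have := mul_mem_lowerSeries ha hb
  rwa [zero_add] at this

theorem W_eq_expIntegral (a : A) : P.W a = expIntegral (P.mul a : Module.End ℚ A) a := rfl

theorem IsNilpotent.isNilpotent_mul (hP : P.IsNilpotent) (a : A) :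
    _root_.IsNilpotent (P.mul a : Module.End ℚ A) := by
  obtain ⟨n, hn⟩ := hP.exists_lowerSeries_eq_bot
  exact isNilpotent_of_mem_flagRaising P.lowerSeries_zero hn (mul_mem_flagRaising a)

theorem pow_mul_apply_sub_mem {i : ℕ} {x y : A} (h : x - y ∈ P.lowerSeries i) (k : ℕ) :
    ((P.mul x : Module.End ℚ A) ^ (k + 1)) x - ((P.mul y : Module.End ℚ A) ^ (k + 1)) y ∈
      P.lowerSeries (i + 1) := by
  have top : ∀ z, z ∈ P.lowerSeries 0 := fun z => by rw [lowerSeries_zero]; trivial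
  have h0 : ∀ k, ((P.mul x : Module.End ℚ A) ^ k) x - ((P.mul y : Module.End ℚ A) ^ k) y ∈
      P.lowerSeries i → ((P.mul x : Module.End ℚ A) ^ (k + 1)) x -
      ((P.mul y : Module.End ℚ A) ^ (k + 1)) y ∈ P.lowerSeries (i + 1) := by
    intro k hk
    rw [pow_succ', pow_succ', Module.End.mul_apply, Module.End.mul_apply]
    have h1 := mul_mem_lowerSeries h (top (((P.mul x : Module.End ℚ A) ^ k) x))
    have h2 := mul_mem_lowerSeries (top y) hk
    rw [add_zero] at h1
    rw [zero_add] at h2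
    have := add_mem h1 h2
    rw [map_sub, map_sub, LinearMap.sub_apply, sub_add_sub_cancel] at this
    exact this
  induction k with
  | zero => exact h0 0 (by simpa using h)
  | succ k ih => exact h0 _ (P.lowerSeries_antitone (Nat.le_succ i) ih)

theorem IsNilpotent.W_sub_mem (hP : P.IsNilpotent) {i : ℕ} {x y : A}
    (h : x - y ∈ P.lowerSeries i) : (P.W x - x) - (P.W y - y) ∈ P.lowerSeries (i + 1) := by
  obtain ⟨n, hn⟩ := hP.exists_lowerSeries_eq_bot
  have hW : ∀ x, P.W x - x = ∑ k ∈ Finset.range n,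
      ((k + 2).factorial : ℚ)⁻¹ • ((P.mul x : Module.End ℚ A) ^ (k + 1)) x := by
    intro x
    have hm : (P.mul x : Module.End ℚ A) ^ (n + 1) = 0 := by
      rw [pow_succ, flagRaising_pow_eq_zero P.lowerSeries_zero hn (mul_mem_flagRaising x), zero_mul]
    rw [W_eq_expIntegral, expIntegral_eq_sum hm, Finset.sum_range_succ']
    simp
  rw [hW, hW, ← Finset.sum_sub_distrib]
  refine Submodule.sum_mem _ fun k _ => ?_
  rw [← smul_sub]
  exact Submodule.smul_mem _ _ (pow_mul_apply_sub_mem h k)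

/-- `W - id` is a sum of terms of degree at least two, hence a contraction for the lower series. -/
theorem IsNilpotent.W_bijective (hP : P.IsNilpotent) : Function.Bijective P.W := by
  obtain ⟨n, hn⟩ := hP.exists_lowerSeries_eq_bot
  have := bijective_add_of_contracting P.lowerSeries_zero hn (fun x => P.W x - x)
    fun i x y h => hP.W_sub_mem h
  simpa using this

theorem W_zero : P.W 0 = 0 := by simp [W]

theorem IsNilpotent.mem_lowerSeries_of_W_mem (hP : P.IsNilpotent) {i : ℕ} {x : A}
    (h : P.W x ∈ P.lowerSeries i) : x ∈ P.lowerSeries i := by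
  refine mem_of_add_mem_of_contracting (p := fun x => P.W x - x) P.lowerSeries_antitone
    P.lowerSeries_zero (fun i x hx => ?_) (by simpa using h)
  have := hP.W_sub_mem (x := x) (y := 0) (i := i) (by simpa using hx)
  simpa [W_zero] using this

/-- The pre-Lie identity, rearranged: left multiplication represents the commutator bracket. -/
theorem mul_bracket (x y : A) :
    P.mul (P.mul x y - P.mul y x) = (P.mul x : Module.End ℚ A) * P.mul y -
      (P.mul y : Module.End ℚ A) * P.mul x := by
  ext z
  simp only [map_sub, LinearMap.sub_apply, Module.End.mul_apply]
  have h := P.preLie x y z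
  rw [sub_eq_sub_iff_add_eq_add] at h ⊢
  rw [add_comm, ← sub_eq_zero] at h
  rw [← sub_eq_zero, ← h]
  abel

/-- Baker-Campbell-Hausdorff for the Lie algebra of the fields `X a`; the two conclusions are the
linear and translation parts of `exp (X x) * exp (X y) = exp (X z)`. -/
theorem IsNilpotent.exists_expL_mul_expL (hP : P.IsNilpotent) (x y : A) :
    ∃ z, P.expL x * P.expL y = P.expL z ∧ P.W z = P.W x + P.expL x (P.W y) := by
  obtain ⟨n, hn⟩ := hP.exists_lowerSeries_eq_bot
  let X : A →ₗ[ℚ] Module.End ℚ (A × ℚ) :=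
    { toFun := fun a => affineField (P.mul a : Module.End ℚ A) a
      map_add' := fun a b => by rw [map_add]; exact affineField_add _ _ _ _
      map_smul' := fun c a => by rw [map_smul]; exact affineField_smul _ _ _ }
  have hX : ∀ a, X a = affineField (P.mul a : Module.End ℚ A) a := fun _ => rfl
  have hanti := affineFlag_antitone P.lowerSeries_antitone
  obtain ⟨_, ⟨z, rfl⟩, hz⟩ := exists_exp_mul_exp_eq_exp (R := Module.End ℚ (A × ℚ))
    (K := flagRaising (affineFlag P.lowerSeries)) (L := LinearMap.range X) (m := n + 1)
    (by
      rintro _ ⟨a, rfl⟩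
      exact affineField_mem_flagRaising P.lowerSeries_zero (mul_mem_flagRaising a) a)
    (fun a ha b hb => flagRaising_mul_mem hanti ha hb)
    (flagRaising_pow_eq_bot rfl (affineFlag_eq_bot hn))
    (by
      rintro _ ⟨a, rfl⟩ _ ⟨b, rfl⟩
      refine ⟨P.mul a b - P.mul b a, ?_⟩
      rw [hX, hX, hX, affineField_mul, affineField_mul, mul_bracket, eq_sub_iff_add_eq,
        ← affineField_add, sub_add_cancel, sub_add_cancel])
    ⟨x, rfl⟩ ⟨y, rfl⟩
  have hexp : ∀ a b s, _root_.IsNilpotent.exp (X a) (b, s) = (P.expL a b + s • P.W a, s) :=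
    fun a b s => exp_affineField_apply (hP.isNilpotent_mul a) a b s
  refine ⟨z, ?_, ?_⟩
  · ext b
    have := congrArg (fun f : Module.End ℚ (A × ℚ) => (f (b, 0)).1) hz
    simpa [hexp] using this
  · have := congrArg (fun f : Module.End ℚ (A × ℚ) => (f (0, 1)).1) hz
    simp only [Module.End.mul_apply, hexp, map_zero, zero_add, one_smul] at this
    rw [← this, add_comm]

/-- The group of flows of a nilpotent pre-Lie algebra. -/
theorem IsNilpotent.exists_groupOfFlows (hP : P.IsNilpotent) :
    ∃ B : QBraceStructure A, B.IsStronglyNilpotent ∧ IsGroupOfFlows P B := by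
  obtain ⟨Ω, hl, hr⟩ := Function.bijective_iff_has_inverse.mp hP.W_bijective
  -- This is `λ_{a∘b} = λ_a λ_b`, from which associativity follows.
  have key : ∀ a b, P.expL (Ω (a + P.expL (Ω a) b)) = P.expL (Ω a) * P.expL (Ω b) := by
    intro a b
    obtain ⟨z, hz, hW⟩ := hP.exists_expL_mul_expL (Ω a) (Ω b)
    rw [hr, hr] at hW
    rw [hz, ← hW, hl]
  have hinv : ∀ a b, P.expL a (_root_.IsNilpotent.exp (-P.mul a : Module.End ℚ A) b) = b := by
    intro a b
    rw [expL, ← Module.End.mul_apply,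
      _root_.IsNilpotent.exp_mul_exp_neg_self (hP.isNilpotent_mul a), Module.End.one_apply]
  let B : QBraceStructure A :=
    { circ := fun a b => a + P.expL (Ω a) b
      isGroup := by
        let _ : Mul A := ⟨fun a b => a + P.expL (Ω a) b⟩
        let _ : One A := ⟨0⟩
        let _ : Inv A := ⟨fun a => _root_.IsNilpotent.exp (-P.mul (Ω a) : Module.End ℚ A) (-a)⟩
        have hmul : ∀ a b : A, a * b = a + P.expL (Ω a) b := fun _ _ => rfl
        have hone : (1 : A) = 0 := rfl
        refine ⟨Group.ofRightAxioms ?_ ?_ ?_, fun a b => rfl⟩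
        · intro a b c
          simp only [hmul]
          rw [key, map_add, Module.End.mul_apply, add_assoc]
        · intro a
          rw [hmul, hone, map_zero, add_zero]
        · intro a
          change a + P.expL (Ω a) (_root_.IsNilpotent.exp (-P.mul (Ω a) : Module.End ℚ A) (-a)) = 0
          rw [hinv, add_neg_cancel]
      circ_add := fun a b c => by simp only [map_add]; abel
      star_smul := fun a b e => by
        simp only [map_smul, add_sub_cancel_left, smul_sub] }
  have hstar : ∀ a b, B.star a b = P.expL (Ω a) b - b := fun a b => by
    change a + P.expL (Ω a) b - a - b = _
    abel
  refine ⟨B, ?_, Ω, hl, hr, fun a b => rfl⟩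
  obtain ⟨n, hn⟩ := hP.exists_lowerSeries_eq_bot
  have hmem : ∀ i j a b, a ∈ P.lowerSeries i → b ∈ P.lowerSeries j →
      B.star a b ∈ P.lowerSeries (i + j + 1) := by
    intro i j a b ha hb
    have hΩa : Ω a ∈ P.lowerSeries i := hP.mem_lowerSeries_of_W_mem (by rwa [hr])
    have hm : (P.mul (Ω a) : Module.End ℚ A) ^ (n + 1) = 0 := by
      rw [pow_succ, flagRaising_pow_eq_zero P.lowerSeries_zero hn (mul_mem_flagRaising _), zero_mul]
    have hk : ∀ k, ((P.mul (Ω a) : Module.End ℚ A) ^ (k + 1)) b ∈ P.lowerSeries (i + j + 1) := by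
      intro k
      induction k with
      | zero => rw [zero_add, pow_one]; exact mul_mem_lowerSeries hΩa hb
      | succ k ih =>
        rw [pow_succ', Module.End.mul_apply]
        exact P.lowerSeries_antitone (by omega) (mul_mem_lowerSeries hΩa ih)
    rw [hstar, expL, _root_.IsNilpotent.exp_eq_sum hm, Finset.sum_range_succ']
    simp only [LinearMap.add_apply, LinearMap.sum_apply, LinearMap.smul_apply]
    simp only [Nat.factorial_zero, Nat.cast_one, inv_one, pow_zero, one_smul, Module.End.one_apply,
      add_sub_cancel_right]
    exact Submodule.sum_mem _ fun k _ => Submodule.smul_mem _ _ (hk k)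
  have hchain : ∀ i, B.strongChain (i + 1) ≤ (P.lowerSeries i).toAddSubgroup := by
    intro i
    induction i using Nat.strong_induction_on with
    | _ i ih =>
    rcases i with _ | i
    · rw [lowerSeries_zero]; exact le_top
    · rw [QBraceStructure.strongChain, AddSubgroup.closure_le]
      rintro x ⟨j, hj0, hj, a, ha, b, hb, rfl⟩
      obtain ⟨j, rfl⟩ : ∃ k, j = k + 1 := ⟨j - 1, by omega⟩
      rw [show i + 2 - (j + 1) = (i - j) + 1 by omega] at hb
      have := hmem _ _ a b (ih j (by omega) ha) (ih (i - j) (by omega) hb)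
      rwa [show j + (i - j) + 1 = i + 1 by omega] at this
  refine ⟨n + 1, ?_⟩
  rw [eq_bot_iff]
  refine (hchain n).trans ?_
  rw [hn]
  exact le_rfl

end PreLieStructure

/-! ### Polynomial sequences, filtered by order of vanishing -/

section Curves

variable {E E' E'' : Type*} [AddCommGroup E] [Module ℚ E] [AddCommGroup E'] [Module ℚ E']
  [AddCommGroup E''] [Module ℚ E'']

/-- The sequences `n ↦ ∑ j, n ^ j • c j` with finitely many terms, `j ≥ k` and `c j ∈ V`. -/
def polyCurves (k : ℕ) (V : Submodule ℚ E) : Submodule ℚ (ℕ → E) :=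
  Submodule.span ℚ {f | ∃ j, k ≤ j ∧ ∃ c ∈ V, f = fun n : ℕ => (n : ℚ) ^ j • c}

theorem polyCurves_mono {k l : ℕ} {V W : Submodule ℚ E} (hkl : l ≤ k) (hVW : V ≤ W) :
    polyCurves k V ≤ polyCurves l W :=
  Submodule.span_mono fun _ ⟨j, hj, c, hc, h⟩ => ⟨j, hkl.trans hj, c, hVW hc, h⟩

theorem monomial_mem_polyCurves {k j : ℕ} (hkj : k ≤ j) {V : Submodule ℚ E} {c : E} (hc : c ∈ V) :
    (fun n : ℕ => (n : ℚ) ^ j • c) ∈ polyCurves k V :=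
  Submodule.subset_span ⟨j, hkj, c, hc, rfl⟩

theorem monomial_mem_polyCurves_top (k : ℕ) (c : E) :
    (fun n : ℕ => (n : ℚ) ^ k • c) ∈ polyCurves k ⊤ := monomial_mem_polyCurves le_rfl trivial

@[elab_as_elim]
theorem polyCurves_induction {k : ℕ} {V : Submodule ℚ E}
    {p : (f : ℕ → E) → f ∈ polyCurves k V → Prop} (zero : p 0 (zero_mem _))
    (add : ∀ f hf g hg, p f hf → p g hg → p (f + g) (add_mem hf hg))
    (monomial : ∀ j (hj : k ≤ j) c (hc : c ∈ V),
      p (fun n : ℕ => (n : ℚ) ^ j • c) (monomial_mem_polyCurves hj hc)) {f : ℕ → E}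
    (hf : f ∈ polyCurves k V) : p f hf := by
  refine Submodule.closure_induction (p := fun f hf => p f hf) zero
    (fun f g hf hg => add f hf g hg) ?_ hf
  rintro r _ ⟨j, hj, c, hc, rfl⟩
  have h := monomial j hj (r • c) (V.smul_mem r hc)
  have e : (r • fun n : ℕ => (n : ℚ) ^ j • c) = fun n : ℕ => (n : ℚ) ^ j • r • c := by
    ext n
    exact smul_comm _ _ _
  simpa only [e] using h

theorem polyCurves_apply_mem {k : ℕ} {V : Submodule ℚ E} {f : ℕ → E} (hf : f ∈ polyCurves k V)
    (n : ℕ) : f n ∈ V := by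
  induction hf using polyCurves_induction with
  | zero => exact zero_mem _
  | add f _ g _ hf hg => exact add_mem hf hg
  | monomial j hj c hc => exact V.smul_mem _ hc

theorem polyCurves_map {k : ℕ} {V : Submodule ℚ E} {V' : Submodule ℚ E'} (T : E →ₗ[ℚ] E')
    (hT : ∀ v ∈ V, T v ∈ V') {f : ℕ → E} (hf : f ∈ polyCurves k V) :
    (fun n => T (f n)) ∈ polyCurves k V' := by
  induction hf using polyCurves_induction with
  | zero => simp only [Pi.zero_apply, map_zero]; exact zero_mem _
  | add f _ g _ hf hg => simp only [Pi.add_apply, map_add]; exact add_mem hf hg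
  | monomial j hj c hc => simpa using monomial_mem_polyCurves hj (hT c hc)

theorem polyCurves_map₂ {k l : ℕ} {V : Submodule ℚ E} {V' : Submodule ℚ E'}
    {V'' : Submodule ℚ E''} (β : E →ₗ[ℚ] E' →ₗ[ℚ] E'') (hβ : ∀ v ∈ V, ∀ w ∈ V', β v w ∈ V'')
    {f : ℕ → E} {g : ℕ → E'} (hf : f ∈ polyCurves k V) (hg : g ∈ polyCurves l V') :
    (fun n => β (f n) (g n)) ∈ polyCurves (k + l) V'' := by
  induction hf using polyCurves_induction with
  | zero => simp only [Pi.zero_apply, map_zero, LinearMap.zero_apply]; exact zero_mem _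
  | add f _ f' _ hf hf' =>
    simp only [Pi.add_apply, map_add, LinearMap.add_apply]
    exact add_mem hf hf'
  | monomial i hi c hc =>
    induction hg using polyCurves_induction with
    | zero => simp only [Pi.zero_apply, map_zero]; exact zero_mem _
    | add g _ g' _ hg hg' => simp only [Pi.add_apply, map_add]; exact add_mem hg hg'
    | monomial j hj d hd =>
      have := monomial_mem_polyCurves (Nat.add_le_add hi hj) (hβ c hc d hd)
      simpa only [map_smul, LinearMap.smul_apply, ← mul_smul, ← pow_add, add_comm i j] using this

theorem polyCurves_comp_pow {l : ℕ} {V : Submodule ℚ E} (j : ℕ) {f : ℕ → E}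
    (hf : f ∈ polyCurves l V) : (fun n => f (n ^ j)) ∈ polyCurves (j * l) V := by
  induction hf using polyCurves_induction with
  | zero => exact (polyCurves (j * l) V).zero_mem
  | add f _ f' _ hf hf' => exact (polyCurves (j * l) V).add_mem hf hf'
  | monomial i hi c hc =>
    have := monomial_mem_polyCurves (Nat.mul_le_mul_left j hi) hc
    simpa [pow_mul] using this

theorem exists_leadingCoeff_of_mem_polyCurves {k : ℕ} {V : Submodule ℚ E} {f : ℕ → E}
    (hf : f ∈ polyCurves k V) :
    ∃ w ∈ V, (fun n : ℕ => f n - (n : ℚ) ^ k • w) ∈ polyCurves (k + 1) V := by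
  induction hf using polyCurves_induction with
  | zero =>
    exact ⟨0, zero_mem _, by simp only [Pi.zero_apply, smul_zero, sub_zero]; exact zero_mem _⟩
  | add f _ g _ hf hg =>
    obtain ⟨w, hw, hf⟩ := hf
    obtain ⟨z, hz, hg⟩ := hg
    refine ⟨w + z, add_mem hw hz, ?_⟩
    convert (polyCurves (k + 1) V).add_mem hf hg using 1
    ext n
    simp
    abel
  | monomial j hj c hc =>
    rcases hj.eq_or_lt with rfl | h
    · exact ⟨c, hc, by simp only [sub_self]; exact zero_mem _⟩
    · exact ⟨0, zero_mem _, by simpa using monomial_mem_polyCurves h hc⟩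

theorem exists_sum_of_mem_polyCurves {k : ℕ} {V : Submodule ℚ E} {f : ℕ → E}
    (hf : f ∈ polyCurves k V) :
    ∃ c : ℕ →₀ E, ∀ n, f n = c.sum fun j v => (n : ℚ) ^ (k + j) • v := by
  induction hf using polyCurves_induction with
  | zero => exact ⟨0, by simp⟩
  | add f _ g _ hf hg =>
    obtain ⟨c, hc⟩ := hf
    obtain ⟨d, hd⟩ := hg
    refine ⟨c + d, fun n => ?_⟩
    rw [Finsupp.sum_add_index' (by simp) (by simp [smul_add])]
    simp [hc, hd]
  | monomial j hj c hc =>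
    refine ⟨Finsupp.single (j - k) c, fun n => ?_⟩
    rw [Finsupp.sum_single_index (by simp), Nat.add_sub_cancel' hj]

open Polynomial in
/-- The scalar polynomial `∑ φ (c j) X ^ (k + j)`. -/
noncomputable def curvePolynomial (k : ℕ) (φ : Module.Dual ℚ E) (c : ℕ →₀ E) : ℚ[X] :=
  c.sum fun j v => monomial (k + j) (φ v)

theorem curvePolynomial_eval (k : ℕ) (φ : Module.Dual ℚ E) (c : ℕ →₀ E) (t : ℚ) :
    (curvePolynomial k φ c).eval t = φ (c.sum fun j v => t ^ (k + j) • v) := by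
  simp [curvePolynomial, Finsupp.sum, Polynomial.eval_finsetSum, mul_comm]

theorem Polynomial.eq_of_forall_eval_natCast {p q : Polynomial ℚ}
    (h : ∀ n : ℕ, p.eval (n : ℚ) = q.eval (n : ℚ)) : p = q :=
  Polynomial.eq_of_infinite_eval_eq p q
    ((Set.infinite_range_of_injective (Nat.cast_injective (R := ℚ))).mono
      (by rintro _ ⟨n, rfl⟩; exact h n))

/-- Uniqueness of coefficients: linear functionals reduce it to rational polynomials, which are
determined by their values at natural numbers. -/
theorem eq_zero_of_monomial_mem_polyCurves {k : ℕ} {V : Submodule ℚ E} {w : E}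
    (h : (fun n : ℕ => (n : ℚ) ^ k • w) ∈ polyCurves (k + 1) V) : w = 0 := by
  obtain ⟨c, hc⟩ := exists_sum_of_mem_polyCurves h
  rw [← Module.forall_dual_apply_eq_zero_iff ℚ]
  intro φ
  have hp : Polynomial.monomial k (φ w) = curvePolynomial (k + 1) φ c := by
    refine Polynomial.eq_of_forall_eval_natCast fun n => ?_
    rw [curvePolynomial_eval, ← hc, map_smul, Polynomial.eval_monomial, smul_eq_mul, mul_comm]
  have := congrArg (fun p => Polynomial.coeff p k) hp
  simp only [Polynomial.coeff_monomial_same, curvePolynomial, Finsupp.sum,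
    Polynomial.finsetSum_coeff] at this
  rw [this]
  refine Finset.sum_eq_zero fun j _ => ?_
  rw [Polynomial.coeff_monomial, if_neg (by omega)]

/-- The values of polynomial sequences at inverses of natural numbers. -/
theorem curve_apply_one_of_scaling {f g : ℕ → E} {k : ℕ} {c d : ℕ →₀ E}
    (hf : ∀ n : ℕ, f n = c.sum fun j v => (n : ℚ) ^ (k + j) • v)
    (hg : ∀ n : ℕ, g n = d.sum fun j v => (n : ℚ) ^ (k + j) • v) {s : ℕ} (hs : s ≠ 0)
    (h : ∀ n, g (s * n) = f n) :
    g 1 = c.sum fun j v => (1 / s : ℚ) ^ (k + j) • v := by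
  rw [← sub_eq_zero, ← Module.forall_dual_apply_eq_zero_iff ℚ]
  intro φ
  -- Agreement at all naturals is a polynomial identity, so it may be evaluated at `1 / s`, where no
  -- sequence is defined.
  have hp : (curvePolynomial k φ d).comp (Polynomial.C (s : ℚ) * Polynomial.X) =
      curvePolynomial k φ c := by
    refine Polynomial.eq_of_forall_eval_natCast fun n => ?_
    have h1 := h n
    rw [hf, hg] at h1
    rw [Polynomial.eval_comp, curvePolynomial_eval, curvePolynomial_eval, ← h1]
    simp
  rw [map_sub, sub_eq_zero, hg, ← curvePolynomial_eval, ← curvePolynomial_eval, ← hp,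
    Polynomial.eval_comp]
  have : (s : ℚ) ≠ 0 := Nat.cast_ne_zero.mpr hs
  simp [this]

section Operators

variable {K : Submodule ℚ (Module.End ℚ E)}

theorem polyCurves_mul_mem {k l : ℕ} {V V' V'' : Submodule ℚ (Module.End ℚ E)}
    (hV : ∀ S ∈ V, ∀ T ∈ V', S * T ∈ V'') {f g : ℕ → Module.End ℚ E} (hf : f ∈ polyCurves k V)
    (hg : g ∈ polyCurves l V') : (fun n => f n * g n) ∈ polyCurves (k + l) V'' :=
  polyCurves_map₂ (LinearMap.mul ℚ (Module.End ℚ E)) hV hf hg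

theorem polyCurves_apply {k l : ℕ} {V : Submodule ℚ (Module.End ℚ E)} {W W' : Submodule ℚ E}
    (hV : ∀ S ∈ V, ∀ b ∈ W, S b ∈ W') {f : ℕ → Module.End ℚ E} {g : ℕ → E}
    (hf : f ∈ polyCurves k V) (hg : g ∈ polyCurves l W) :
    (fun n => f n (g n)) ∈ polyCurves (k + l) W' :=
  polyCurves_map₂ (LinearMap.id : Module.End ℚ E →ₗ[ℚ] Module.End ℚ E) hV hf hg

theorem mul_sub_one_mem_polyCurves (hK : ∀ S ∈ K, ∀ T ∈ K, S * T ∈ K) {k : ℕ}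
    {U U' : ℕ → Module.End ℚ E} (hU : (fun n => U n - 1) ∈ polyCurves k K)
    (hU' : (fun n => U' n - 1) ∈ polyCurves k K) :
    (fun n => U n * U' n - 1) ∈ polyCurves k K := by
  have h := polyCurves_mono (Nat.le_add_right k k) le_rfl (polyCurves_mul_mem hK hU hU')
  convert add_mem (add_mem h hU) hU' using 1
  ext n : 1
  simp only [Pi.add_apply]
  noncomm_ring

/-- The inverse is the finite geometric series in `1 - U n`. -/
theorem inv_sub_one_mem_polyCurves (hK : ∀ S ∈ K, ∀ T ∈ K, S * T ∈ K) {k m : ℕ}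
    (hm : ∀ T ∈ K, T ^ m = 0)
    {U U' : ℕ → Module.End ℚ E} (hU : (fun n => U n - 1) ∈ polyCurves k K)
    (h' : ∀ n, U' n * U n = 1) :
    (fun n => U' n - 1) ∈ polyCurves k K := by
  have hN : (fun n => 1 - U n) ∈ polyCurves k K := by
    convert neg_mem hU using 1
    ext n : 1
    simp
  have hp : ∀ j, (fun n => (1 - U n) ^ (j + 1)) ∈ polyCurves k K := by
    intro j
    induction j with
    | zero => simpa using hN
    | succ j ih =>
      simp only [pow_succ _ (j + 1)]
      exact polyCurves_mono (Nat.le_add_right k k) le_rfl (polyCurves_mul_mem hK ih hN)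
  have hsum : (∑ j ∈ Finset.range m, fun n => (1 - U n) ^ (j + 1)) ∈ polyCurves k K :=
    Submodule.sum_mem _ fun j _ => hp j
  convert hsum using 1
  ext n : 1
  have h0 : (1 - U n) ^ (m + 1) = 0 := by
    rw [pow_succ, hm _ (polyCurves_apply_mem hN n), zero_mul]
  have hg := mul_neg_geom_sum (1 - U n) (m + 1)
  rw [h0, sub_zero, sub_sub_cancel] at hg
  rw [left_inv_eq_right_inv (h' n) hg, Finset.sum_range_succ', Finset.sum_apply]
  simp

/-- Comparison of the coefficients of `n` and `n ^ 2` in `S G = U V`. -/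
theorem coeff_identities_of_mul_eq
    {S G U V : ℕ → Module.End ℚ E} {s u v qs qu qv g : Module.End ℚ E}
    (hS : (fun n : ℕ => S n - 1 - (n : ℚ) ^ 1 • s - (n : ℚ) ^ 2 • qs) ∈ polyCurves 3 ⊤)
    (hU : (fun n : ℕ => U n - 1 - (n : ℚ) ^ 1 • u - (n : ℚ) ^ 2 • qu) ∈ polyCurves 3 ⊤)
    (hV : (fun n : ℕ => V n - 1 - (n : ℚ) ^ 1 • v - (n : ℚ) ^ 2 • qv) ∈ polyCurves 3 ⊤)
    (hG : (fun n : ℕ => G n - 1 - (n : ℚ) ^ 2 • g) ∈ polyCurves 3 ⊤)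
    (h : ∀ n, S n * G n = U n * V n) :
    s - u - v = 0 ∧ qs + g - qu - qv - u * v = 0 := by
  have hmul : ∀ {k l : ℕ} {f g : ℕ → Module.End ℚ E}, f ∈ polyCurves k ⊤ → g ∈ polyCurves l ⊤ →
      (fun n => f n * g n) ∈ polyCurves (k + l) ⊤ := fun hf hg =>
    polyCurves_mul_mem (V := ⊤) (V' := ⊤) (V'' := ⊤) (fun _ _ _ _ => trivial) hf hg
  have two : ∀ {T : ℕ → Module.End ℚ E} {t : Module.End ℚ E},
      (fun n : ℕ => T n - (n : ℚ) ^ 2 • t) ∈ polyCurves 3 ⊤ → T ∈ polyCurves 2 ⊤ := by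
    intro T t hT
    convert add_mem (polyCurves_mono (Nat.le_succ 2) le_rfl hT)
      (monomial_mem_polyCurves_top 2 t) using 1
    ext n : 1
    simp only [Pi.add_apply, sub_add_cancel]
  have one : ∀ {T : ℕ → Module.End ℚ E} {t : Module.End ℚ E},
      (fun n : ℕ => T n - (n : ℚ) ^ 1 • t) ∈ polyCurves 2 ⊤ → T ∈ polyCurves 1 ⊤ := by
    intro T t hT
    convert add_mem (polyCurves_mono (Nat.le_succ 1) le_rfl hT)
      (monomial_mem_polyCurves_top 1 t) using 1
    ext n : 1
    simp only [Pi.add_apply, sub_add_cancel]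
  have hSG := hmul (one (two hS)) (two hG)
  have hUV : (fun n : ℕ => (U n - 1) * (V n - 1) - (n : ℚ) ^ 2 • (u * v)) ∈ polyCurves 3 ⊤ := by
    have h1 := hmul (two hU) (one (two hV))
    have h2 := hmul (monomial_mem_polyCurves_top 1 u) (two hV)
    convert add_mem h1 h2 using 1
    ext n : 1
    simp only [Pi.add_apply]
    rw [sub_mul (U n - 1) _ (V n - 1), mul_sub ((n : ℚ) ^ 1 • u) (V n - 1),
      sub_add_sub_cancel, smul_mul_smul_comm, ← pow_add]
  -- Both sides of `S G = U V` are expanded around `1`. In degree at most two, the only product term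
  -- is `n² u v`, since `(S - 1)(G - 1)` has order three.
  have key : (fun n : ℕ => (n : ℚ) ^ 1 • (s - u - v) +
      (n : ℚ) ^ 2 • (qs + g - qu - qv - u * v)) ∈ polyCurves 3 ⊤ := by
    convert sub_mem (add_mem (add_mem hU hV) hUV) (add_mem (add_mem hS hG) hSG) using 1
    ext n : 1
    simp only [Pi.add_apply, Pi.sub_apply]
    have e1 : ∀ S T : Module.End ℚ E, (S - 1) * (T - 1) = S * T - S - T + 1 := fun S T => by
      noncomm_ring
    rw [e1, e1, h n]
    module
  have h1 : s - u - v = 0 := by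
    refine eq_zero_of_monomial_mem_polyCurves (k := 1) (V := ⊤) ?_
    convert sub_mem (polyCurves_mono (Nat.le_succ 2) le_rfl key) (monomial_mem_polyCurves_top 2
      (qs + g - qu - qv - u * v)) using 1
    ext n : 1
    simp only [Pi.sub_apply, add_sub_cancel_right]
  refine ⟨h1, eq_zero_of_monomial_mem_polyCurves (k := 2) (V := ⊤) ?_⟩
  simpa only [h1, smul_zero, zero_add] using key

end Operators

end Curves

/-! ### The map `λ`, the strong chain and one-parameter subgroups -/

namespace QBraceStructure

variable {A : Type*} [AddCommGroup A] [Module ℚ A] (B : QBraceStructure A)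

theorem circ_zero (a : A) : B.circ a 0 = a := by
  have h := B.circ_add a 0 0
  rw [add_zero] at h
  exact (add_left_cancel h).symm

theorem circ_assoc (a b c : A) : B.circ (B.circ a b) c = B.circ a (B.circ b c) := by
  obtain ⟨_, h⟩ := B.isGroup
  simp only [h, mul_assoc]

theorem zero_circ (a : A) : B.circ 0 a = a := by
  obtain ⟨_, h⟩ := B.isGroup
  have h0 : (1 : A) = 0 := by rw [← B.circ_zero 1, h, one_mul]
  rw [h, ← h0, one_mul]

theorem exists_inv (a : A) : ∃ b, B.circ a b = 0 ∧ B.circ b a = 0 := by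
  obtain ⟨_, h⟩ := B.isGroup
  have h0 : (1 : A) = 0 := by rw [← B.circ_zero 1, h, one_mul]
  exact ⟨a⁻¹, by rw [h, mul_inv_cancel, h0], by rw [h, inv_mul_cancel, h0]⟩

/-- The linear map `b ↦ a ∘ b - a`. -/
def lam (a : A) : Module.End ℚ A where
  toFun b := B.circ a b - a
  map_add' b c := by
    have h := B.circ_add a b c
    rw [← eq_sub_iff_add_eq] at h
    rw [h]; abel
  map_smul' e b := by
    have h := B.star_smul a b e
    rw [sub_eq_iff_eq_add] at h
    rw [h, RingHom.id_apply, ← smul_add, sub_add_cancel]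

theorem lam_apply (a b : A) : B.lam a b = B.circ a b - a := rfl

theorem circ_eq (a b : A) : B.circ a b = a + B.lam a b := by rw [lam_apply]; abel

theorem star_eq (a b : A) : B.star a b = (B.lam a - 1) b := rfl

theorem lam_circ (a b : A) : B.lam (B.circ a b) = B.lam a * B.lam b := by
  ext c
  have h := B.circ_assoc a b c
  rw [circ_eq, B.circ_eq a b, B.circ_eq b c, circ_eq, map_add, ← add_assoc] at h
  rw [B.circ_eq a b]
  exact add_left_cancel h

theorem lam_zero : B.lam 0 = 1 := by
  ext c
  rw [lam_apply, zero_circ, sub_zero, Module.End.one_apply]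

/-- The inverse of `b ↦ a ∘ b - a`. -/
noncomputable def lamInv (a : A) : Module.End ℚ A := B.lam (B.exists_inv a).choose

theorem lam_mul_lamInv (a : A) : B.lam a * B.lamInv a = 1 := by
  rw [lamInv, ← lam_circ, (B.exists_inv a).choose_spec.1, lam_zero]

theorem lamInv_mul_lam (a : A) : B.lamInv a * B.lam a = 1 := by
  rw [lamInv, ← lam_circ, (B.exists_inv a).choose_spec.2, lam_zero]

theorem add_eq_circ (a b : A) : a + b = B.circ a (B.lamInv a b) := by
  rw [circ_eq, ← Module.End.mul_apply, lam_mul_lamInv, Module.End.one_apply]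

/-- `λ` is multiplicative for `∘`, not for `+`; this rule trades a sum for a product at the cost of
twisting the second summand. -/
theorem lam_add (a b : A) : B.lam (a + b) = B.lam a * B.lam (B.lamInv a b) := by
  rw [add_eq_circ, lam_circ]

theorem strongChain_antitone : Antitone B.strongChain := by
  refine antitone_nat_of_succ_le fun i => ?_
  induction i using Nat.strong_induction_on with
  | _ i ih =>
  rcases i with _ | _ | i
  · rw [strongChain]; exact le_top
  · rw [show B.strongChain (0 + 1) = ⊤ by rw [strongChain]]; exact le_top
  · rw [strongChain, AddSubgroup.closure_le]
    rintro x ⟨j, hj0, hj, a, ha, b, hb, rfl⟩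
    rw [show i + 1 + 1 = i + 2 from rfl, strongChain]
    refine AddSubgroup.subset_closure ?_
    -- One index must drop by one: that of `b` if `j = 1`, that of `a` otherwise.
    by_cases h : j = 1
    · subst h
      refine ⟨1, one_pos, by omega, a, ha, b, ?_, rfl⟩
      rw [show i + 1 + 2 - 1 = (i + 2 - 1) + 1 by omega] at hb
      exact ih _ (by omega) hb
    · obtain ⟨j, rfl⟩ : ∃ k, j = k + 1 := ⟨j - 1, by omega⟩
      refine ⟨j, by omega, by omega, a, ih j (by omega) ha, b, ?_, rfl⟩
      rwa [show i + 1 + 2 - (j + 1) = i + 2 - j by omega] at hb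

theorem star_mem_strongChain {i j : ℕ} {a b : A} (ha : a ∈ B.strongChain (i + 1))
    (hb : b ∈ B.strongChain (j + 1)) : B.star a b ∈ B.strongChain (i + j + 2) := by
  rw [strongChain]
  refine AddSubgroup.subset_closure ⟨i + 1, by omega, by omega, a, ha, b, ?_, rfl⟩
  rwa [show i + j + 2 - (i + 1) = j + 1 by omega]

/-- Scalars enter a generator `a * b` through `b`, the argument in which `*` is linear. -/
theorem smul_mem_strongChain (i : ℕ) (c : ℚ) {x : A} (hx : x ∈ B.strongChain i) :
    c • x ∈ B.strongChain i := by
  induction i using Nat.strong_induction_on generalizing x with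
  | _ i ih =>
  rcases i with _ | _ | i
  · rw [strongChain]; trivial
  · rw [strongChain]; trivial
  · rw [strongChain] at hx ⊢
    induction hx using AddSubgroup.closure_induction with
    | mem x hx =>
      obtain ⟨j, hj0, hj, a, ha, b, hb, rfl⟩ := hx
      refine AddSubgroup.subset_closure ⟨j, hj0, hj, a, ha, c • b, ih _ (by omega) hb, ?_⟩
      rw [star_eq, star_eq, map_smul]
    | zero => rw [smul_zero]; exact zero_mem _
    | add x y _ _ hx hy => rw [smul_add]; exact add_mem hx hy
    | neg x _ hx => rw [smul_neg]; exact neg_mem hx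

/-- The subspace `A^{[i + 1]}`. -/
def series (i : ℕ) : Submodule ℚ A where
  carrier := B.strongChain (i + 1)
  add_mem' := add_mem
  zero_mem' := zero_mem _
  smul_mem' c _ hx := B.smul_mem_strongChain _ c hx

theorem series_antitone : Antitone B.series :=
  fun _ _ hij _ hx => B.strongChain_antitone (Nat.succ_le_succ hij) hx

theorem series_zero : B.series 0 = ⊤ := by
  rw [eq_top_iff]
  intro x _
  change x ∈ B.strongChain (0 + 1)
  rw [strongChain]; trivial

theorem mem_series_zero (x : A) : x ∈ B.series 0 := by rw [series_zero]; trivial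

variable {B}

theorem IsStronglyNilpotent.exists_series_eq_bot (hB : B.IsStronglyNilpotent) :
    ∃ n, B.series n = ⊥ := by
  obtain ⟨n, hn⟩ := hB
  refine ⟨n, eq_bot_iff.mpr fun x hx => ?_⟩
  have := B.strongChain_antitone (Nat.le_succ n) hx
  rwa [hn] at this

theorem lam_sub_one_apply_mem {i j : ℕ} {a b : A} (ha : a ∈ B.series i) (hb : b ∈ B.series j) :
    (B.lam a - 1) b ∈ B.series (i + j + 1) := B.star_mem_strongChain ha hb

theorem lam_sub_one_mem (a : A) : B.lam a - 1 ∈ flagRaising B.series := by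
  intro i b hb
  have := lam_sub_one_apply_mem (B.mem_series_zero a) hb
  rwa [zero_add] at this

variable (B)

/-- The operator `(b, s) ↦ (λ_a b + s a, s)` of the affine action of `(A, ∘)`. -/
noncomputable def affineLam (a : A) : Module.End ℚ (A × ℚ) := 1 + affineField (B.lam a - 1) a

theorem affineLam_apply (a b : A) (s : ℚ) : B.affineLam a (b, s) = (B.lam a b + s • a, s) := by
  refine Prod.ext ?_ ?_ <;> simp [affineLam, affineField_apply]
  abel

theorem affineLam_circ (a b : A) :
    B.affineLam (B.circ a b) = B.affineLam a * B.affineLam b := by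
  refine LinearMap.ext fun ⟨c, s⟩ => ?_
  rw [Module.End.mul_apply, affineLam_apply, affineLam_apply, affineLam_apply, lam_circ, circ_eq,
    map_add, map_smul, smul_add, Module.End.mul_apply]
  congr 1
  abel

/-- The powers of `a` in the group `(A, ∘)`. -/
def circPow (a : A) : ℕ → A
  | 0 => 0
  | n + 1 => B.circ (circPow a n) a

theorem affineLam_circPow (a : A) (n : ℕ) : B.affineLam (B.circPow a n) = B.affineLam a ^ n := by
  induction n with
  | zero =>
    refine LinearMap.ext fun ⟨c, s⟩ => ?_
    rw [affineLam_apply, circPow, lam_zero]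
    simp
  | succ n ih => rw [circPow, affineLam_circ, ih, pow_succ]

variable {B}

theorem IsStronglyNilpotent.exists_exp_eq_affineLam (hB : B.IsStronglyNilpotent) (a : A) :
    ∃ D ∈ flagRaising B.series, ∃ v, IsNilpotent.exp (affineField D v) = B.affineLam a := by
  obtain ⟨n, hn⟩ := hB.exists_series_eq_bot
  have hanti := affineFlag_antitone B.series_antitone
  set N := affineField (B.lam a - 1) a with hN
  have hNK : N ∈ flagRaising (affineFlag B.series) :=
    affineField_mem_flagRaising B.series_zero (lam_sub_one_mem a) a
  have hN0 : N ^ (n + 1) = 0 := flagRaising_pow_eq_zero rfl (affineFlag_eq_bot hn) hNK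
  obtain ⟨q, hq, hexp⟩ := IsNilpotent.exists_exp_mul_eq_one_add n N hN0
  -- The polynomial `q` may have a constant term and need not raise the flag; right multiplication
  -- by it nevertheless preserves flag-raising operators.
  have hqK : N * q ∈ flagRaising (affineFlag B.series) := by
    refine (?_ : ∀ T ∈ flagRaising (affineFlag B.series),
      T * q ∈ flagRaising (affineFlag B.series)) N hNK
    clear hexp
    induction hq using Algebra.adjoin_induction with
    | mem x hx => rw [hx]; exact fun T hT => flagRaising_mul_mem hanti hT hNK
    | algebraMap r =>
      intro T hT
      rw [← Algebra.commutes, ← Algebra.smul_def]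
      exact Submodule.smul_mem _ r hT
    | add x y _ _ hx hy => intro T hT; rw [mul_add]; exact add_mem (hx T hT) (hy T hT)
    | mul x y _ _ hx hy => intro T hT; rw [← mul_assoc]; exact hy _ (hx T hT)
  obtain ⟨D, hD, v, hv⟩ := exists_eq_affineField hqK
  exact ⟨D, hD, v, by rw [← hv, hexp]; rfl⟩

/-- Every element generates a one-parameter subgroup whose integer points are its powers. -/
theorem IsStronglyNilpotent.exists_oneParameter (hB : B.IsStronglyNilpotent) (a : A) :
    ∃ D ∈ flagRaising B.series, ∃ v, ∀ n : ℕ,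
      B.lam (B.circPow a n) = IsNilpotent.exp ((n : ℚ) • D) ∧
      B.circPow a n = expIntegral ((n : ℚ) • D) ((n : ℚ) • v) := by
  obtain ⟨N, hN⟩ := hB.exists_series_eq_bot
  obtain ⟨D, hD, v, h⟩ := hB.exists_exp_eq_affineLam a
  have hDn : ∀ c : ℚ, IsNilpotent (c • D) := fun c =>
    isNilpotent_of_mem_flagRaising B.series_zero hN (Submodule.smul_mem _ c hD)
  have hpow : ∀ n : ℕ, IsNilpotent.exp (affineField ((n : ℚ) • D) ((n : ℚ) • v)) =
      B.affineLam (B.circPow a n) := by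
    intro n
    have hX := isNilpotent_affineField (by simpa using hDn 1) v
    rw [affineLam_circPow, ← h, affineField_smul, IsNilpotent.exp_natCast_smul hX]
  refine ⟨D, hD, v, fun n => ⟨?_, ?_⟩⟩
  · ext b
    have := congrArg (fun f : Module.End ℚ (A × ℚ) => (f (b, 0)).1) (hpow n)
    simpa [exp_affineField_apply (hDn n), affineLam_apply] using this.symm
  · have := congrArg (fun f : Module.End ℚ (A × ℚ) => (f (0, 1)).1) (hpow n)
    simpa [exp_affineField_apply (hDn n), affineLam_apply] using this.symm

end QBraceStructure

/-! ### Exponentials `exp(nD)` as polynomial sequences -/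

section ExponentialCurves

variable {A : Type*} [AddCommGroup A] [Module ℚ A] {F : ℕ → Submodule ℚ A}

theorem exp_smul_eq_sum {N : ℕ} {D : Module.End ℚ A} (hD : D ^ N = 0) (t : ℚ) :
    IsNilpotent.exp (t • D) =
      ∑ k ∈ Finset.range N, t ^ (k + 1) • ((k + 1).factorial : ℚ)⁻¹ • D ^ (k + 1) + 1 := by
  have h : (t • D) ^ (N + 1) = 0 := by
    rw [smul_pow, pow_succ D, hD, zero_mul, smul_zero]
  rw [IsNilpotent.exp_eq_sum h, Finset.sum_range_succ']
  congr 1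
  · exact Finset.sum_congr rfl fun k _ => by rw [smul_pow, smul_comm]
  · simp

theorem expIntegral_smul_eq_sum_of_mem_flagRaising (hF0 : F 0 = ⊤) {N : ℕ} (hN : F N = ⊥)
    {D : Module.End ℚ A} (hD : D ∈ flagRaising F) (t : ℚ) (v : A) :
    expIntegral (t • D) (t • v) =
      ∑ k ∈ Finset.range N, t ^ (k + 2) • ((k + 2).factorial : ℚ)⁻¹ • (D ^ (k + 1)) v +
        t • v := by
  have h : (t • D) ^ (N + 1) = 0 := by
    rw [pow_succ, flagRaising_pow_eq_zero hF0 hN (Submodule.smul_mem _ t hD), zero_mul]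
  rw [expIntegral_eq_sum h, Finset.sum_range_succ']
  congr 1
  · refine Finset.sum_congr rfl fun k _ => ?_
    rw [smul_pow, LinearMap.smul_apply, map_smul, smul_smul (t ^ (k + 1)), ← pow_succ,
      smul_comm]
  · simp

theorem pow_succ_apply_mem_of_mem_flagRaising (hF : Antitone F) {D : Module.End ℚ A}
    (hD : D ∈ flagRaising F) {i : ℕ} {v : A} (hv : v ∈ F i) (k : ℕ) :
    (D ^ (k + 1)) v ∈ F (i + 1) := flagRaising_pow_succ_mem hF hD k i v hv

theorem exp_smul_sub_one_mem_polyCurves (hF : Antitone F) (hF0 : F 0 = ⊤) {N : ℕ}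
    (hN : F N = ⊥) {D : Module.End ℚ A} (hD : D ∈ flagRaising F) :
    (fun n : ℕ => IsNilpotent.exp ((n : ℚ) • D) - 1) ∈ polyCurves 1 (flagRaising F) := by
  simp only [exp_smul_eq_sum (flagRaising_pow_eq_zero hF0 hN hD), add_sub_cancel_right]
  convert Submodule.sum_mem _ (t := Finset.range N) fun k _ => monomial_mem_polyCurves (k := 1)
    (show 1 ≤ k + 1 by omega) (Submodule.smul_mem _ ((k + 1).factorial : ℚ)⁻¹
      (flagRaising_pow_succ_mem hF hD k)) using 1
  ext n : 1
  rw [Finset.sum_apply]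

theorem exp_smul_sub_linear_mem_polyCurves {D : Module.End ℚ A} (hD : IsNilpotent D) :
    (fun n : ℕ => IsNilpotent.exp ((n : ℚ) • D) - 1 - (n : ℚ) ^ 1 • D) ∈ polyCurves 2 ⊤ := by
  obtain ⟨N, hN⟩ := hD
  have h : ∀ n : ℕ, IsNilpotent.exp ((n : ℚ) • D) - 1 - (n : ℚ) ^ 1 • D =
      ∑ k ∈ Finset.range N, (n : ℚ) ^ (k + 2) • ((k + 2).factorial : ℚ)⁻¹ • D ^ (k + 2) := by
    intro n
    have hs := Finset.sum_range_succ
      (fun k => (n : ℚ) ^ (k + 1) • ((k + 1).factorial : ℚ)⁻¹ • D ^ (k + 1)) N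
    rw [Finset.sum_range_succ', pow_succ D N, hN, zero_mul] at hs
    rw [exp_smul_eq_sum hN, add_sub_cancel_right, sub_eq_iff_eq_add]
    simpa using hs.symm
  simp only [h]
  convert Submodule.sum_mem _ (t := Finset.range N) fun k _ => monomial_mem_polyCurves (k := 2)
    (show 2 ≤ k + 2 by omega) (c := ((k + 2).factorial : ℚ)⁻¹ • D ^ (k + 2)) (V := ⊤)
      trivial using 1
  ext n : 1
  rw [Finset.sum_apply]

theorem expIntegral_smul_sub_mem_polyCurves (hF : Antitone F) (hF0 : F 0 = ⊤) {N : ℕ}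
    (hN : F N = ⊥) {D : Module.End ℚ A} (hD : D ∈ flagRaising F) {i : ℕ} {v : A} (hv : v ∈ F i) :
    (fun n : ℕ => expIntegral ((n : ℚ) • D) ((n : ℚ) • v) - (n : ℚ) • v) ∈
      polyCurves 2 (F (i + 1)) := by
  simp only [expIntegral_smul_eq_sum_of_mem_flagRaising hF0 hN hD, add_sub_cancel_right]
  convert Submodule.sum_mem _ (t := Finset.range N) fun k _ => monomial_mem_polyCurves (k := 2)
    (show 2 ≤ k + 2 by omega) (Submodule.smul_mem _ ((k + 2).factorial : ℚ)⁻¹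
      (pow_succ_apply_mem_of_mem_flagRaising hF hD hv k)) using 1
  ext n : 1
  rw [Finset.sum_apply]

theorem expIntegral_sub_mem (hF : Antitone F) (hF0 : F 0 = ⊤) {N : ℕ}
    (hN : F N = ⊥) {D : Module.End ℚ A} (hD : D ∈ flagRaising F) {i : ℕ} {v : A} (hv : v ∈ F i) :
    expIntegral D v - v ∈ F (i + 1) := by
  simpa using polyCurves_apply_mem (expIntegral_smul_sub_mem_polyCurves hF hF0 hN hD hv) 1

/-- For fixed `D`, `v ↦ expIntegral D v` is the identity plus a contraction, so the velocity lies as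
deep in the flag as the endpoint. -/
theorem mem_of_expIntegral_mem (hF : Antitone F) (hF0 : F 0 = ⊤) {N : ℕ}
    (hN : F N = ⊥) {D : Module.End ℚ A} (hD : D ∈ flagRaising F) {i : ℕ} {v : A}
    (hv : expIntegral D v ∈ F i) : v ∈ F i :=
  mem_of_add_mem_of_contracting (p := fun x => expIntegral D x - x) hF hF0
    (fun _ _ hx => expIntegral_sub_mem hF hF0 hN hD hx) (by simpa using hv)

theorem apply_mem_polyCurves (hF : Antitone F) {k l i : ℕ} {U : ℕ → Module.End ℚ A}
    (hU : (fun n => U n - 1) ∈ polyCurves k (flagRaising F)) {f : ℕ → A}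
    (hf : f ∈ polyCurves l (F i)) : (fun n => U n (f n)) ∈ polyCurves l (F i) := by
  have h := polyCurves_apply (V := flagRaising F) (fun S hS b hb => hS i b hb) hU hf
  convert add_mem (polyCurves_mono (Nat.le_add_left l k) (hF (Nat.le_succ i)) h) hf using 1
  ext n
  simp

end ExponentialCurves

/-! ### Polynomiality of `λ` -/

namespace QBraceStructure

variable {A : Type*} [AddCommGroup A] [Module ℚ A] {B : QBraceStructure A}

theorem IsStronglyNilpotent.lamInv_mem_polyCurves (hB : B.IsStronglyNilpotent) {k : ℕ}
    {f : ℕ → A} (hf : (fun n => B.lam (f n) - 1) ∈ polyCurves k (flagRaising B.series)) :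
    (fun n => B.lamInv (f n) - 1) ∈ polyCurves k (flagRaising B.series) := by
  obtain ⟨N, hN⟩ := hB.exists_series_eq_bot
  exact inv_sub_one_mem_polyCurves (fun _ hS _ hT => flagRaising_mul_mem B.series_antitone hS hT)
    (fun _ hT => flagRaising_pow_eq_zero B.series_zero hN hT) hf fun n => B.lamInv_mul_lam _

theorem lam_mul_mem_polyCurves {k : ℕ}
    {U V : ℕ → Module.End ℚ A} (hU : (fun n => U n - 1) ∈ polyCurves k (flagRaising B.series))
    (hV : (fun n => V n - 1) ∈ polyCurves k (flagRaising B.series)) :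
    (fun n => U n * V n - 1) ∈ polyCurves k (flagRaising B.series) :=
  mul_sub_one_mem_polyCurves (fun _ hS _ hT => flagRaising_mul_mem B.series_antitone hS hT) hU hV

theorem circPow_one (a : A) : B.circPow a 1 = a := B.zero_circ a

/-- `λ` maps polynomial sequences to polynomial sequences. -/
theorem IsStronglyNilpotent.lam_sub_one_mem_polyCurves_of_series (hB : B.IsStronglyNilpotent)
    (d : ℕ) :
    ∀ (i k : ℕ) (f : ℕ → A), B.series (i + d) = ⊥ → f ∈ polyCurves k (B.series i) →
      (fun n => B.lam (f n) - 1) ∈ polyCurves k (flagRaising B.series) := by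
  -- Descending induction along the chain: `d` bounds the number of steps from `series i` down to
  -- zero.
  induction d with
  | zero =>
    intro i k f hi hf
    have : ∀ n, f n = 0 := fun n => by
      have := polyCurves_apply_mem hf n
      rwa [← add_zero i, hi, Submodule.mem_bot] at this
    simp only [this, lam_zero, sub_self]
    exact zero_mem _
  | succ d ihd =>
    intro i k f hi hf
    obtain ⟨N, hN⟩ := hB.exists_series_eq_bot
    have hanti := B.series_antitone
    have ih : ∀ (k : ℕ) (f : ℕ → A), f ∈ polyCurves k (B.series (i + 1)) →
        (fun n => B.lam (f n) - 1) ∈ polyCurves k (flagRaising B.series) := fun k f hf =>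
      ihd (i + 1) k f (by rw [← hi]; congr 1; omega) hf
    induction hf using polyCurves_induction with
    | zero => simp only [Pi.zero_apply, lam_zero, sub_self]; exact zero_mem _
    -- `λ_g⁻¹ h = h + r` with `r` one step deeper, so `λ_{g+h} = λ_g λ_h λ_{λ_h⁻¹ r}`, and induction
    -- handles the last factor.
    | add g hg h hh hlg hlh =>
      have hgi := hB.lamInv_mem_polyCurves hlg
      have hhi := hB.lamInv_mem_polyCurves hlh
      have hr := polyCurves_mono (Nat.le_add_left k k) le_rfl
        (polyCurves_apply (V := flagRaising B.series) (fun S hS b hb => hS i b hb) hgi hh)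
      have hr' := ih k _ (apply_mem_polyCurves hanti hhi hr)
      convert lam_mul_mem_polyCurves hlg (lam_mul_mem_polyCurves hlh hr') using 1
      ext n : 1
      rw [← lam_add, Pi.add_apply, lam_add]
      congr 3
      simp
    -- The sequence `n c` agrees with the power `c^{∘n}` up to an error one step deeper. On powers
    -- `λ` is `exp(nD)`, and induction handles the error; finally `n` is replaced by `n ^ j`.
    | monomial j hj c hc =>
      obtain ⟨D, hD, v, hp⟩ := hB.exists_oneParameter c
      have hcv : c = expIntegral D v := by simpa [circPow_one] using (hp 1).2
      have hv : v ∈ B.series i :=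
        mem_of_expIntegral_mem hanti B.series_zero hN hD (by rwa [← hcv])
      have hlp : (fun n => B.lam (B.circPow c n) - 1) ∈ polyCurves 1 (flagRaising B.series) := by
        simp only [(hp _).1]
        exact exp_smul_sub_one_mem_polyCurves hanti B.series_zero hN hD
      have hr : (fun n : ℕ => (n : ℚ) • c - B.circPow c n) ∈ polyCurves 1 (B.series (i + 1)) := by
        have h1 := polyCurves_mono (Nat.le_succ 1) le_rfl
          (expIntegral_smul_sub_mem_polyCurves hanti B.series_zero hN hD hv)
        have h2 := monomial_mem_polyCurves (le_refl 1)
          (expIntegral_sub_mem hanti B.series_zero hN hD hv)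
        convert sub_mem h2 h1 using 1
        ext n
        simp only [Pi.sub_apply, (hp n).2, pow_one, ← hcv, smul_sub]
        abel
      have hs := ih 1 _ (apply_mem_polyCurves hanti (hB.lamInv_mem_polyCurves hlp) hr)
      have hlin : (fun n : ℕ => B.lam ((n : ℚ) • c) - 1) ∈
          polyCurves 1 (flagRaising B.series) := by
        convert lam_mul_mem_polyCurves hlp hs using 1
        ext n : 1
        rw [← lam_add, add_sub_cancel]
      have := polyCurves_mono (hj.trans (mul_one j).ge) le_rfl (polyCurves_comp_pow j hlin)
      simpa using this

theorem IsStronglyNilpotent.lam_sub_one_mem_polyCurves (hB : B.IsStronglyNilpotent) {k : ℕ}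
    {f : ℕ → A} (hf : f ∈ polyCurves k ⊤) :
    (fun n => B.lam (f n) - 1) ∈ polyCurves k (flagRaising B.series) := by
  obtain ⟨N, hN⟩ := hB.exists_series_eq_bot
  rw [← B.series_zero] at hf
  exact hB.lam_sub_one_mem_polyCurves_of_series N 0 k f (by rwa [zero_add]) hf

end QBraceStructure

/-! ### From strongly nilpotent braces to pre-Lie algebras -/

namespace QBraceStructure

variable {A : Type*} [AddCommGroup A] [Module ℚ A] {B : QBraceStructure A}

theorem IsStronglyNilpotent.exists_linearPart (hB : B.IsStronglyNilpotent) (a : A) :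
    ∃ L : Module.End ℚ A,
      (fun n : ℕ => B.lam ((n : ℚ) ^ 1 • a) - 1 - (n : ℚ) ^ 1 • L) ∈ polyCurves 2 ⊤ := by
  obtain ⟨L, -, hL⟩ := exists_leadingCoeff_of_mem_polyCurves
    (polyCurves_mono le_rfl le_top
      (hB.lam_sub_one_mem_polyCurves (monomial_mem_polyCurves_top 1 a)))
  exact ⟨L, hL⟩

/-- The linear coefficient of `n ↦ λ_{n a}`. -/
noncomputable def IsStronglyNilpotent.linearPart (hB : B.IsStronglyNilpotent) (a : A) :
    Module.End ℚ A := (hB.exists_linearPart a).choose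

theorem IsStronglyNilpotent.lam_smul_sub_linearPart (hB : B.IsStronglyNilpotent) (a : A) :
    (fun n : ℕ => B.lam ((n : ℚ) ^ 1 • a) - 1 - (n : ℚ) ^ 1 • hB.linearPart a) ∈
      polyCurves 2 ⊤ := (hB.exists_linearPart a).choose_spec

/-- The leading term of `λ` along a polynomial sequence. -/
theorem IsStronglyNilpotent.lam_sub_linearPart_mem (hB : B.IsStronglyNilpotent) {k : ℕ}
    (hk : 1 ≤ k) {f : ℕ → A} {w : A}
    (hf : (fun n : ℕ => f n - (n : ℚ) ^ k • w) ∈ polyCurves (k + 1) ⊤) :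
    (fun n : ℕ => B.lam (f n) - 1 - (n : ℚ) ^ k • hB.linearPart w) ∈ polyCurves (k + 1) ⊤ := by
  -- Write `λ_{f(n)}` as `λ_{n^k w}` times `λ` of a term of order `k + 1`; the first factor is the
  -- linear case at `n ^ k`.
  have hU := polyCurves_mono (show k + 1 ≤ k * 2 by omega) le_rfl
    (polyCurves_comp_pow k (hB.lam_smul_sub_linearPart w))
  simp only [pow_one, Nat.cast_pow] at hU
  have hw := hB.lam_sub_one_mem_polyCurves (monomial_mem_polyCurves_top k w)
  have hh : (fun n : ℕ => B.lamInv ((n : ℚ) ^ k • w) (f n - (n : ℚ) ^ k • w)) ∈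
      polyCurves (k + 1) ⊤ := by
    rw [← B.series_zero] at hf ⊢
    exact apply_mem_polyCurves B.series_antitone (hB.lamInv_mem_polyCurves hw) hf
  have hV := polyCurves_mono le_rfl le_top (hB.lam_sub_one_mem_polyCurves hh)
  have hUV := polyCurves_mono (show k + 1 ≤ k + (k + 1) by omega) le_rfl
    (polyCurves_mul_mem (V'' := ⊤) (fun _ _ _ _ => trivial) hw hV)
  convert add_mem (add_mem hU hV) hUV using 1
  ext n : 1
  have h := B.lam_add ((n : ℚ) ^ k • w) (f n - (n : ℚ) ^ k • w)
  rw [add_sub_cancel] at h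
  simp only [Pi.add_apply]
  rw [h, sub_mul, mul_sub, one_mul, mul_one]
  abel

theorem IsStronglyNilpotent.exists_quadraticPart (hB : B.IsStronglyNilpotent) (a : A) :
    ∃ Q : Module.End ℚ A, (fun n : ℕ => B.lam ((n : ℚ) ^ 1 • a) - 1 -
      (n : ℚ) ^ 1 • hB.linearPart a - (n : ℚ) ^ 2 • Q) ∈ polyCurves 3 ⊤ := by
  obtain ⟨Q, -, hQ⟩ := exists_leadingCoeff_of_mem_polyCurves (hB.lam_smul_sub_linearPart a)
  exact ⟨Q, hQ⟩

/-- The discrepancy between `na ∘ nb` and `n(a + b)`, written as a right `∘`-factor of the latter,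
has leading term `n² L_a b`. -/
theorem IsStronglyNilpotent.lamInv_star_sub_mem (hB : B.IsStronglyNilpotent) (a b : A) :
    (fun n : ℕ => B.lamInv ((n : ℚ) ^ 1 • (a + b))
      ((B.lam ((n : ℚ) ^ 1 • a) - 1) ((n : ℚ) ^ 1 • b)) - (n : ℚ) ^ 2 • hB.linearPart a b) ∈
      polyCurves 3 ⊤ := by
  have hlam : ∀ c : A, (fun n : ℕ => B.lam ((n : ℚ) ^ 1 • c) - 1) ∈
      polyCurves 1 (flagRaising B.series) :=
    fun c => hB.lam_sub_one_mem_polyCurves (monomial_mem_polyCurves_top 1 c)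
  have happ : ∀ {k l : ℕ} {f : ℕ → Module.End ℚ A} {g : ℕ → A}, f ∈ polyCurves k ⊤ →
      g ∈ polyCurves l ⊤ → (fun n => f n (g n)) ∈ polyCurves (k + l) ⊤ := fun hf hg =>
    polyCurves_apply (V := ⊤) (W := ⊤) (W' := ⊤) (fun _ _ _ _ => trivial) hf hg
  have hb := monomial_mem_polyCurves_top 1 b
  have h1 := happ (polyCurves_mono le_rfl le_top (hB.lamInv_mem_polyCurves (hlam (a + b))))
    (happ (polyCurves_mono le_rfl le_top (hlam a)) hb)
  have h2 := happ (hB.lam_smul_sub_linearPart a) hb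
  convert add_mem h1 h2 using 1
  ext n
  simp only [Pi.add_apply]
  rw [LinearMap.sub_apply _ ((n : ℚ) ^ 1 • hB.linearPart a), LinearMap.smul_apply,
    map_smul (hB.linearPart a), smul_smul, ← pow_add, LinearMap.sub_apply (B.lamInv _),
    Module.End.one_apply]
  abel

/-- The coefficients of `n` and `n ^ 2` in `λ_{n a ∘ n b} = λ_{n a} λ_{n b}`. -/
theorem IsStronglyNilpotent.exists_linearPart_identities (hB : B.IsStronglyNilpotent) :
    ∃ Q : A → Module.End ℚ A, ∀ a b,
      hB.linearPart (a + b) - hB.linearPart a - hB.linearPart b = 0 ∧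
      Q (a + b) + hB.linearPart (hB.linearPart a b) - Q a - Q b -
        hB.linearPart a * hB.linearPart b = 0 := by
  choose Q hQ using hB.exists_quadraticPart
  refine ⟨Q, fun a b => coeff_identities_of_mul_eq (hQ (a + b)) (hQ a) (hQ b)
    (hB.lam_sub_linearPart_mem one_le_two (hB.lamInv_star_sub_mem a b)) fun n => ?_⟩
  rw [← lam_add, ← lam_circ, circ_eq, smul_add, LinearMap.sub_apply, Module.End.one_apply]
  congr 1
  abel

/-- The pre-Lie structure given by the linear coefficients of `n ↦ λ_{n a}`. -/
noncomputable def IsStronglyNilpotent.preLieStructure (hB : B.IsStronglyNilpotent) :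
    PreLieStructure A where
  mul := AddMonoidHom.toRatLinearMap
    (AddMonoidHom.mk' hB.linearPart fun a b => by
      obtain ⟨Q, hQ⟩ := hB.exists_linearPart_identities
      have := (hQ a b).1
      rwa [sub_sub, sub_eq_zero] at this)
  preLie x y z := by
    -- The unknown `Q` enters symmetrically in `x` and `y`, so it cancels from the difference of the
    -- two quadratic identities.
    obtain ⟨Q, hQ⟩ := hB.exists_linearPart_identities
    have h1 := congrArg (fun f : Module.End ℚ A => f z) (hQ x y).2
    have h2 := congrArg (fun f : Module.End ℚ A => f z) (hQ y x).2
    rw [add_comm y x] at h2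
    simp only [LinearMap.sub_apply, LinearMap.add_apply, Module.End.mul_apply,
      LinearMap.zero_apply] at h1 h2
    change hB.linearPart (hB.linearPart x y) z - hB.linearPart x (hB.linearPart y z) =
      hB.linearPart (hB.linearPart y x) z - hB.linearPart y (hB.linearPart x z)
    rw [← sub_eq_zero]
    rw [← h2, ← sub_eq_zero] at h1
    rw [← h1]
    abel

/-- All values `(λ_{na} - 1) b` lie in `series (i + j + 1)`; in the quotient by it, `n L_a b` is
therefore of order two, hence zero. -/
theorem IsStronglyNilpotent.linearPart_apply_mem (hB : B.IsStronglyNilpotent) {i j : ℕ} {a b : A}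
    (ha : a ∈ B.series i) (hb : b ∈ B.series j) :
    hB.linearPart a b ∈ B.series (i + j + 1) := by
  rw [← Submodule.Quotient.mk_eq_zero]
  refine eq_zero_of_monomial_mem_polyCurves (k := 1) (V := ⊤) ?_
  have h := polyCurves_map (V' := ⊤) ((B.series (i + j + 1)).mkQ.comp (LinearMap.applyₗ b))
    (fun _ _ => trivial) (hB.lam_smul_sub_linearPart a)
  convert neg_mem h using 1
  ext n
  have h0 : (B.series (i + j + 1)).mkQ ((B.lam ((n : ℚ) ^ 1 • a) - 1) b) = 0 := by
    rw [Submodule.mkQ_apply, Submodule.Quotient.mk_eq_zero]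
    exact lam_sub_one_apply_mem (Submodule.smul_mem _ _ ha) hb
  rw [Pi.neg_apply, map_sub, LinearMap.comp_apply, LinearMap.applyₗ_apply_apply, h0]
  simp

theorem IsStronglyNilpotent.preLieStructure_isNilpotent (hB : B.IsStronglyNilpotent) :
    hB.preLieStructure.IsNilpotent := by
  obtain ⟨N, hN⟩ := hB.exists_series_eq_bot
  have h : ∀ n x, hB.preLieStructure.IsProduct n x → x ∈ B.series (n - 1) := by
    intro n x hx
    induction hx with
    | single a => exact B.mem_series_zero a
    | @mul m n a b ha hb iha ihb =>
      have := ha.pos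
      have := hb.pos
      have h := hB.linearPart_apply_mem iha ihb
      rwa [show m - 1 + (n - 1) + 1 = m + n - 1 by omega] at h
  refine ⟨N + 1, by omega, fun x hx => ?_⟩
  have := h _ x hx
  rwa [Nat.add_sub_cancel, hN, Submodule.mem_bot] at this

theorem IsStronglyNilpotent.isGroupOfFlows (hB : B.IsStronglyNilpotent) :
    IsGroupOfFlows hB.preLieStructure B := by
  obtain ⟨N, hN⟩ := hB.exists_series_eq_bot
  have hanti := B.series_antitone
  have hflow : ∀ a, ∃ v, hB.preLieStructure.W v = a ∧ hB.preLieStructure.expL v = B.lam a := by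
    intro a
    obtain ⟨D, hD, v, hp⟩ := hB.exists_oneParameter a
    have hc : (fun n => B.circPow a n - (n : ℚ) ^ 1 • v) ∈ polyCurves 2 ⊤ := by
      have := expIntegral_smul_sub_mem_polyCurves hanti B.series_zero hN hD (B.mem_series_zero v)
      simp only [(hp _).2, pow_one]
      exact polyCurves_mono le_rfl le_top this
    have h1 := hB.lam_sub_linearPart_mem le_rfl hc
    have h2 := exp_smul_sub_linear_mem_polyCurves
      (isNilpotent_of_mem_flagRaising B.series_zero hN hD)
    -- Two expansions of `λ_{a^{∘n}}` are compared: it equals `exp(nD)`, and `a^{∘n} = nv + O(n²)`.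
    have hL : D - hB.linearPart v = 0 := by
      refine eq_zero_of_monomial_mem_polyCurves (k := 1) (V := ⊤) ?_
      convert sub_mem h1 h2 using 1
      ext n : 1
      simp only [Pi.sub_apply, (hp n).1]
      module
    rw [sub_eq_zero] at hL
    have h1 := hp 1
    rw [circPow_one, Nat.cast_one, one_smul, one_smul, hL] at h1
    exact ⟨v, h1.2.symm, h1.1.symm⟩
  obtain ⟨Ω, hl, hr⟩ := Function.bijective_iff_has_inverse.mp
    hB.preLieStructure_isNilpotent.W_bijective
  refine ⟨Ω, hl, hr, fun a b => ?_⟩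
  obtain ⟨v, hv, hv'⟩ := hflow a
  rw [← hv, hl, hv', hv, circ_eq]

end QBraceStructure

/-! ### The limit formula -/

section Limit

variable {E : Type*} [AddCommGroup E] [Module ℚ E]

theorem convergesTo_add_sum (w : E) (c : ℕ →₀ E) :
    ConvergesTo (fun n : ℕ => w + c.sum fun j v => (1 / 2 ^ n : ℚ) ^ (j + 1) • v) w := by
  classical
  have hw : w ∈ Submodule.span ℚ (insert w (c '' c.support)) :=
    Submodule.subset_span (Set.mem_insert _ _)
  refine ⟨Submodule.span ℚ (insert w (c '' c.support)), ?_, fun n => ?_, hw, fun φ => ?_⟩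
  · exact FiniteDimensional.span_of_finite ℚ ((c.support.finite_toSet.image c).insert w)
  · refine add_mem hw (Submodule.sum_mem _ fun j hj => Submodule.smul_mem _ _ ?_)
    exact Submodule.subset_span (Set.mem_insert_of_mem _ ⟨j, hj, rfl⟩)
  · have h : ∀ j ∈ c.support,
        Tendsto (fun n : ℕ => (1 / 2 ^ n : ℚ) ^ (j + 1) * φ (c j)) atTop (𝓝 0) := by
      intro j _
      have h1 : Tendsto (fun n : ℕ => ((1 / 2 : ℚ) ^ (j + 1)) ^ n) atTop (𝓝 0) :=
        tendsto_pow_atTop_nhds_zero_of_lt_one (by positivity)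
          (pow_lt_one₀ (by norm_num) (by norm_num) (by omega))
      have h2 := h1.mul_const (φ (c j))
      rw [zero_mul] at h2
      refine h2.congr fun n => ?_
      rw [← pow_mul, mul_comm (j + 1) n, pow_mul, one_div_pow]
    have hs := (tendsto_finsetSum c.support h).const_add (φ w)
    rw [Finset.sum_const_zero, add_zero] at hs
    refine hs.congr fun n => ?_
    simp [Finsupp.sum, map_sum]

end Limit

theorem QBraceStructure.IsStronglyNilpotent.isLimitProduct {A : Type*} [AddCommGroup A]
    [Module ℚ A] {B : QBraceStructure A} (hB : B.IsStronglyNilpotent) :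
    IsLimitProduct B hB.preLieStructure := by
  intro a b
  have happ : ∀ {k : ℕ} {f : ℕ → Module.End ℚ A}, f ∈ polyCurves k ⊤ →
      (fun n => f n b) ∈ polyCurves k ⊤ := fun hf =>
    polyCurves_map (V := ⊤) (V' := ⊤) (LinearMap.applyₗ b) (fun _ _ => trivial) hf
  obtain ⟨c, hc⟩ := exists_sum_of_mem_polyCurves (happ (hB.lam_smul_sub_linearPart a))
  set w := hB.linearPart a b with hw
  -- Coefficients of `(λ_{na} - 1) b` counted from degree one: `w` first, then the tail `c`, counted
  -- from degree two, shifted by one.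
  let c' : ℕ →₀ A := Finsupp.single 0 w + c.mapDomain Nat.succ
  have hsum : ∀ t : ℚ, (c'.sum fun j v => t ^ (1 + j) • v) =
      t • w + c.sum fun j v => t ^ (2 + j) • v := by
    intro t
    rw [Finsupp.sum_add_index' (by simp) (by simp [smul_add]),
      Finsupp.sum_single_index (by simp),
      Finsupp.sum_mapDomain_index (by simp) (by simp [smul_add])]
    simp [add_comm, add_left_comm, Nat.succ_eq_add_one]
  have hf : ∀ n : ℕ, (B.lam ((n : ℚ) ^ 1 • a) - 1) b = c'.sum fun j v => (n : ℚ) ^ (1 + j) • v := by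
    intro n
    rw [hsum, ← hc]
    simp [hw]
  have hlim := convergesTo_add_sum w c
  rw [show hB.preLieStructure.mul a b = w from rfl]
  convert hlim using 2 with m
  -- For fixed `m`, the sequence attached to `a / 2^m` is also polynomial and recovers that of `a`
  -- at multiples of `2^m`; its value at `1` is thus the polynomial of `a` at `1 / 2^m`.
  obtain ⟨d, hd⟩ := exists_sum_of_mem_polyCurves (happ (polyCurves_mono le_rfl le_top
    (hB.lam_sub_one_mem_polyCurves
      (monomial_mem_polyCurves_top 1 ((1 / 2 ^ m : ℚ) • a)))))
  have h2 : (2 ^ m : ℚ) ≠ 0 := by positivity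
  have := curve_apply_one_of_scaling hf hd (s := 2 ^ m) (by positivity) (by
    intro n
    rw [smul_smul]
    congr 4
    push_cast
    field_simp)
  rw [hsum] at this
  simp only [Nat.cast_one, one_pow, one_smul] at this
  rw [QBraceStructure.star_eq, this, smul_add, smul_smul, Finsupp.smul_sum]
  push_cast
  rw [mul_one_div_cancel h2, one_smul]
  congr 1
  refine Finsupp.sum_congr fun j _ => ?_
  rw [smul_smul]
  congr 1
  rw [show 2 + j = (j + 1) + 1 by omega, pow_succ _ (j + 1)]
  field_simp

/-- `exp X` determines its powers `exp(nX)`, whose linear coefficient in `n` is `X`. -/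
theorem exp_injective_of_isNilpotent {E : Type*} [AddCommGroup E] [Module ℚ E]
    {X Y : Module.End ℚ E} (hX : IsNilpotent X) (hY : IsNilpotent Y)
    (h : IsNilpotent.exp X = IsNilpotent.exp Y) : X = Y := by
  rw [← sub_eq_zero]
  refine eq_zero_of_monomial_mem_polyCurves (k := 1) (V := ⊤) ?_
  convert sub_mem (exp_smul_sub_linear_mem_polyCurves hY)
    (exp_smul_sub_linear_mem_polyCurves hX) using 1
  ext n : 1
  simp only [Pi.sub_apply, IsNilpotent.exp_natCast_smul hX, IsNilpotent.exp_natCast_smul hY, h]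
  module

/-! ### Each structure determines the other -/

section Uniqueness

variable {A : Type*} [AddCommGroup A] [Module ℚ A]

theorem IsGroupOfFlows.brace_unique {P : PreLieStructure A} {B B' : QBraceStructure A}
    (h : IsGroupOfFlows P B) (h' : IsGroupOfFlows P B') : B = B' := by
  obtain ⟨Ω, hl, hr, hB⟩ := h
  obtain ⟨Ω', hl', hr', hB'⟩ := h'
  have hΩ : Ω = Ω' := by
    ext a
    rw [← hr' a, hl, hl']
  ext a b
  rw [hB, hB', hΩ]

theorem IsGroupOfFlows.preLie_unique {P P' : PreLieStructure A} {B : QBraceStructure A}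
    (hP : P.IsNilpotent) (hP' : P'.IsNilpotent)
    (h : IsGroupOfFlows P B) (h' : IsGroupOfFlows P' B) : P = P' := by
  obtain ⟨Ω, hl, hr, hB⟩ := h
  obtain ⟨Ω', hl', hr', hB'⟩ := h'
  ext x : 2
  set x' := Ω' (P.W x) with hx'
  have hW : P'.W x' = P.W x := hr' _
  have hexp : P.expL x = P'.expL x' := by
    ext b
    have h1 := hB (P.W x) b
    rw [hB', hl] at h1
    exact (add_left_cancel h1).symm
  -- The affine fields of `x` and `x'` have the same exponential, hence coincide: `x = x'` from the
  -- translation parts, then equal left multiplications.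
  have hX := affineField_injective (exp_injective_of_isNilpotent
    (isNilpotent_affineField (hP.isNilpotent_mul x) x)
    (isNilpotent_affineField (hP'.isNilpotent_mul x') x') (by
      refine LinearMap.ext fun ⟨b, s⟩ => ?_
      rw [exp_affineField_apply (hP.isNilpotent_mul x),
        exp_affineField_apply (hP'.isNilpotent_mul x')]
      change (P.expL x b + s • P.W x, s) = (P'.expL x' b + s • P'.W x', s)
      rw [hexp, hW]))
  rw [← hX.2] at hX
  exact hX.1

end Uniqueness

theorem mainTheorem3 (A : Type*) [AddCommGroup A] [Module ℚ A] :
    ∃ e : {B : QBraceStructure A // B.IsStronglyNilpotent} ≃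
        {P : PreLieStructure A // P.IsNilpotent},
      (∀ B : {B : QBraceStructure A // B.IsStronglyNilpotent}, IsLimitProduct B.1 (e B).1) ∧
      (∀ P : {P : PreLieStructure A // P.IsNilpotent}, IsGroupOfFlows P.1 (e.symm P).1) := by
  choose G hG hflow using fun P : {P : PreLieStructure A // P.IsNilpotent} =>
    P.2.exists_groupOfFlows
  refine ⟨⟨fun B => ⟨B.2.preLieStructure, B.2.preLieStructure_isNilpotent⟩,
    fun P => ⟨G P, hG P⟩, fun B => ?_, fun P => ?_⟩, fun B => B.2.isLimitProduct, hflow⟩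
  · exact Subtype.ext ((hflow _).brace_unique B.2.isGroupOfFlows)
  · exact Subtype.ext (IsGroupOfFlows.preLie_unique (hG P).preLieStructure_isNilpotent P.2
      (hG P).isGroupOfFlows (hflow P))
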